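/- **Setting.** Let $\mathcal H$ be a real Hilbert space, $m\ge 1$ and $n$ integers, and $0\le\sigma_i<\beta_i\le+\infty$ for $i=1,\dots,m$. For $0\le\sigma<\beta\le+\infty$ let $\mathcal F_{\sigma,\beta}$ be the class of functions $f:\mathcal H\to\mathbb R\cup\{+\infty\}$ that are $\sigma$-strongly convex (that is, $f$ is proper and $f-\frac{\sigma}{2}\|\cdot\|^2$ is convex) and, moreover, $\beta$-smooth (differentiable with $\beta$-Lipschitz gradient) if $\beta<+\infty$, respectively lower semicontinuous if $\beta=+\infty$. The subdifferential is $\partial f(x)=\{u: f(y)\ge f(x)+\langle u,y-x\rangle\ \forall y\in\mathcal H\}$. For $f_i\in\mathcal F_{\sigma_i,\beta_i}$ write $\mathbf f(\mathbf y)=(f_1(y^{(1)}),\dots,f_m(y^{(m)}))$ and $\boldsymbol\partial\mathbf f(\mathbf y)=\prod_{i}\partial f_i(y^{(i)})$, and let $\boldsymbol{\mathcal F}$ be the set of all such $\mathbf f$. For a matrix $M\in\mathbb R^{k\times p}$, $M\otimes\mathrm{Id}:\mathcal H^p\to\mathcal H^k$ is the map $\mathbf z\mapsto(\sum_j M_{ij}z^{(j)})_i$,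 and $\mathcal Q(M,\mathbf z)=\langle\mathbf z,(M\otimes\mathrm{Id})\mathbf z\rangle$ for symmetric $M$. Let $A\in\mathbb R^{n\times n}$, $B\in\mathbb R^{n\times m}$, $C\in\mathbb R^{m\times n}$, $D\in\mathbb R^{m\times m}$ and $N=\begin{bmatrix}I\\-\mathbf 1^\top\end{bmatrix}\in\mathbb R^{m\times(m-1)}$; when $m=1$ the block columns containing $N$ and the block rows containing $N^\top$ as their only nonzero blocks are removed (in $E_{i,j}$, $\Sigma_i$ below, a block row whose only nonzero block is $N$ then becomes a zero row). **Assumptions.** (1) $\mathrm{ran}\begin{bmatrix}BN&0\\DN&-\mathbf 1\end{bmatrix}\subseteq\mathrm{ran}\begin{bmatrix}I-A\\-C\end{bmatrix}$ and $\mathrm{null}\begin{bmatrix}I-A&-B\end{bmatrix}\subseteq\mathrm{null}\begin{bmatrix}N^\top C&N^\top D\\0&\mathbf 1^\top\end{bmatrix}$. (2) $D$ is lower triangular with nonpositive diagonal, and for each $i$ we have $\beta_i<+\infty$ or $D_{ii}<0$. **Performance estimation problem.** Let $\mathcal S=\mathcal H^n\times\mathcal H^m\times\mathcal H^m\times\mathbb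 R^m$, with elements $\boldsymbol\xi=(\mathbf x,\mathbf u,\mathbf y,\mathbf F)$. For $Q_{ø},Q_+\in\mathbb S^{n+2m}$ and $q_{ø},q_+\in\mathbb R^m$ let $$\Phi(\boldsymbol\xi,\boldsymbol\xi_+,\boldsymbol\xi_\star)=\mathcal Q(Q_{ø},(\mathbf x-\mathbf x_\star,\mathbf u,\mathbf u_\star))+q_{ø}^\top(\mathbf F-\mathbf F_\star)+\mathcal Q(Q_+,(\mathbf x_+-\mathbf x_\star,\mathbf u_+,\mathbf u_\star))+q_+^\top(\mathbf F_+-\mathbf F_\star).$$ Let $S_\Phi^\star\in[-\infty,+\infty]$ be the supremum of $\Phi(\boldsymbol\xi,\boldsymbol\xi_+,\boldsymbol\xi_\star)$ over all $\mathbf f\in\boldsymbol{\mathcal F}$ and $\boldsymbol\xi,\boldsymbol\xi_+,\boldsymbol\xi_\star\in\mathcal S$ such that each of the three points satisfies $\mathbf y=(C\otimes\mathrm{Id})\mathbf x+(D\otimes\mathrm{Id})\mathbf u$, $\mathbf u\in\boldsymbol\partial\mathbf f(\mathbf y)$, $\mathbf F=\mathbf f(\mathbf y)$ (with the corresponding subscripts),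 and in addition $\mathbf x_+=(A\otimes\mathrm{Id})\mathbf x+(B\otimes\mathrm{Id})\mathbf u$ and $\mathbf x_\star=(A\otimes\mathrm{Id})\mathbf x_\star+(B\otimes\mathrm{Id})\mathbf u_\star$. **Matrices.** Let $e_l$ be the standard basis vectors of $\mathbb R^m$, $\mathbf a_l=-e_l$, and $$\mathbf M_l=\frac1{2(\beta_l-\sigma_l)}\begin{bmatrix}\beta_l\sigma_l&-\sigma_l&\beta_l\\-\sigma_l&1&-1\\\beta_l&-1&1\end{bmatrix}\otimes\mathrm{diag}(e_l)\ \text{ if }\beta_l<\infty,\qquad \mathbf M_l=\frac12\begin{bmatrix}\sigma_l&0&1\\0&0&0\\1&0&0\end{bmatrix}\otimes\mathrm{diag}(e_l)\ \text{ if }\beta_l=+\infty.$$ Let $$E_{ø,+}=\begin{bmatrix}C(I-A)&D-CB&-D&CBN\\0&I&0&0\\0&0&I&0\end{bmatrix},\quad E_{+,ø}=\begin{bmatrix}C(A-I)&CB-D&D&-CBN\\0&0&I&0\\0&I&0&0\end{bmatrix},$$ $$E_{ø,\star}=\begin{bmatrix}C&D&0&-DN\\0&I&0&0\\0&0&0&N\end{bmatrix},\quad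 E_{\star,ø}=\begin{bmatrix}-C&-D&0&DN\\0&0&0&N\\0&I&0&0\end{bmatrix},$$ $$E_{+,\star}=\begin{bmatrix}CA&CB&D&-DN-CBN\\0&0&I&0\\0&0&0&N\end{bmatrix},\quad E_{\star,+}=\begin{bmatrix}-CA&-CB&-D&DN+CBN\\0&0&0&N\\0&0&I&0\end{bmatrix},$$ $$H_{ø,+}=-H_{+,ø}=[I\ \ {-I}],\quad H_{ø,\star}=-H_{\star,ø}=[I\ \ 0],\quad H_{+,\star}=-H_{\star,+}=[0\ \ I],$$ $$\mathbf M_{(l,i,j)}=E_{i,j}^\top\mathbf M_lE_{i,j},\qquad \mathbf a_{(l,i,j)}=H_{i,j}^\top\mathbf a_l,$$ $$\Sigma_{ø}=\begin{bmatrix}I&0&0&0\\0&I&0&0\\0&0&0&N\end{bmatrix},\quad \Sigma_+=\begin{bmatrix}A&B&0&-BN\\0&0&I&0\\0&0&0&N\end{bmatrix},\quad \mathbf Q=\Sigma_{ø}^\top Q_{ø}\Sigma_{ø}+\Sigma_+^\top Q_+\Sigma_+,\quad \mathbf q=(q_{ø},q_+).$$ **Lemma.** Let $\mathcal I=\{ø,\star\}$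 or $\mathcal I=\{ø,+,\star\}$, suppose that assumptions (1) and (2) hold, and suppose that the formula for $\Phi$ depends only on the variables with indices in $\mathcal I$ (a variable without subscript has index $ø$). If there are scalars $\lambda_{(l,i,j)}$ such that $$\lambda_{(l,i,j)}\ge0\ \text{ for all } l\in\{1,\dots,m\}\text{ and distinct }i,j\in\mathcal I,$$ $$-\mathbf Q+\sum_{l=1}^m\sum_{\substack{i,j\in\mathcal I\\i\ne j}}\lambda_{(l,i,j)}\mathbf M_{(l,i,j)}\succeq0,\qquad -\mathbf q+\sum_{l=1}^m\sum_{\substack{i,j\in\mathcal I\\i\ne j}}\lambda_{(l,i,j)}\mathbf a_{(l,i,j)}=0,$$ then $S_\Phi^\star\le0$. Conversely, if $\dim\mathcal H\ge n+3m-1$, and there are a symmetric positive definite $G\in\mathbb R^{(n+3m-1)\times(n+3m-1)}$ and $\boldsymbol\chi\in\mathbb R^{2m}$ with $\mathbf a_{(l,i,j)}^\top\boldsymbol\chi+\mathrm{trace}(\mathbf M_{(l,i,j)}G)\le0$ for all $l\in\{1,\dots,m\}$ and distinct $i,j\in\mathcal I$, then $S_\Phi^\star\le0$ implies that such scalars $\lambda_{(l,i,j)}$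 exist. -/

import Mathlib

open scoped NNReal ENNReal Kronecker

noncomputable section

namespace QuadPEP

/-! ### Extended-real-valued convex functions on a real Hilbert space

Functions with values in `ℝ ∪ {+∞}` are functions into `EReal` that never take the value `⊥`. -/

section Functions

variable {H : Type*} [NormedAddCommGroup H] [InnerProductSpace ℝ H]

/-- `f` takes the value `+∞` not everywhere. -/
def Proper (f : H → EReal) : Prop := ∃ x, f x < ⊤

/-- Convexity of a function with values in `ℝ ∪ {+∞}`. -/
def ConvexFun (f : H → EReal) : Prop :=
  ∀ x y : H, ∀ t : ℝ, 0 ≤ t → t ≤ 1 →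
    f ((1 - t) • x + t • y) ≤ ((1 - t : ℝ) : EReal) * f x + (t : EReal) * f y

/-- `f` is proper and `f - (σ/2)‖·‖²` is convex. -/
def StronglyConvexFun (σ : ℝ) (f : H → EReal) : Prop :=
  Proper f ∧ ConvexFun (fun x => f x - ((σ / 2 * ‖x‖ ^ 2 : ℝ) : EReal))

/-- `f` is real-valued and differentiable, with `β`-Lipschitz gradient. -/
def SmoothFun [CompleteSpace H] (β : ℝ) (f : H → EReal) : Prop :=
  ∃ g : H → ℝ, (∀ x, f x = (g x : EReal)) ∧ Differentiable ℝ g ∧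
    ∀ x y, ‖gradient g x - gradient g y‖ ≤ β * ‖x - y‖

/-- The class of `σ`-strongly convex functions `H → ℝ ∪ {+∞}` that are `β`-smooth if `β < ∞` and
lower semicontinuous if `β = ∞`. -/
def FunClass (H : Type*) [NormedAddCommGroup H] [InnerProductSpace ℝ H] [CompleteSpace H]
    (σ : ℝ≥0) (β : ℝ≥0∞) : Set (H → EReal) :=
  {f | (∀ x, f x ≠ ⊥) ∧ StronglyConvexFun (σ : ℝ) f ∧
    (β < ⊤ → SmoothFun β.toReal f) ∧ (β = ⊤ → LowerSemicontinuous f)}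

/-- The subdifferential. -/
def subdiff (f : H → EReal) (x : H) : Set H :=
  {u | ∀ y, f x + ((inner ℝ u (y - x) : ℝ) : EReal) ≤ f y}

/-- The map `M ⊗ Id : H^κ → H^ι`. -/
def tensorId {ι κ : Type*} [Fintype κ] (M : Matrix ι κ ℝ) (z : κ → H) : ι → H :=
  fun i => ∑ j, M i j • z j

/-- The quadratic form `⟨z, (M ⊗ Id) z⟩` on `H^ι`. -/
def quadForm {ι : Type*} [Fintype ι] (M : Matrix ι ι ℝ) (z : ι → H) : ℝ :=
  ∑ i, inner ℝ (z i) (tensorId M z i)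

end Functions

/-! ### The algorithm -/

/-- The indices `ø` (current point), `+` (successor), `⋆` (fixed point). -/
inductive Idx
  | cur
  | succ
  | fix
  deriving DecidableEq

/-- The points `ξ = (x, u, y, F)` of `H^n × H^m × H^m × ℝ^m`. -/
structure Point (H : Type*) (n m : ℕ) where
  x : Fin n → H
  u : Fin m → H
  y : Fin m → H
  F : Fin m → ℝ

section Algorithm

variable {H : Type*} [NormedAddCommGroup H] [InnerProductSpace ℝ H] {n m : ℕ}

/-- `ξ` is algorithm-consistent for `f`:
`y = (C ⊗ Id) x + (D ⊗ Id) u`, `u ∈ ∂f(y)`, `F = f(y)`. -/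
def AlgConsistent (C : Matrix (Fin m) (Fin n) ℝ) (D : Matrix (Fin m) (Fin m) ℝ)
    (f : Fin m → H → EReal) (ξ : Point H n m) : Prop :=
  ξ.y = tensorId C ξ.x + tensorId D ξ.u ∧
  (∀ i, ξ.u i ∈ subdiff (f i) (ξ.y i)) ∧
  (∀ i, (ξ.F i : EReal) = f i (ξ.y i))

/-- `ξp` is a successor of `ξ`. -/
def IsSuccessor (A : Matrix (Fin n) (Fin n) ℝ) (B : Matrix (Fin n) (Fin m) ℝ)
    (C : Matrix (Fin m) (Fin n) ℝ) (D : Matrix (Fin m) (Fin m) ℝ)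
    (f : Fin m → H → EReal) (ξ ξp : Point H n m) : Prop :=
  ξp.x = tensorId A ξ.x + tensorId B ξ.u ∧ AlgConsistent C D f ξp

/-- `ξs` satisfies the fixed-point equations. -/
def IsFixedPoint (A : Matrix (Fin n) (Fin n) ℝ) (B : Matrix (Fin n) (Fin m) ℝ)
    (C : Matrix (Fin m) (Fin n) ℝ) (D : Matrix (Fin m) (Fin m) ℝ)
    (f : Fin m → H → EReal) (ξs : Point H n m) : Prop :=
  ξs.x = tensorId A ξs.x + tensorId B ξs.u ∧ AlgConsistent C D f ξs

/-- The quadratic objective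
`𝒬(Qø, (x - x⋆, u, u⋆)) + qøᵀ(F - F⋆) + 𝒬(Q₊, (x₊ - x⋆, u₊, u⋆)) + q₊ᵀ(F₊ - F⋆)`
as a function of the triple `(ξ, ξ₊, ξ⋆)`, which is given as a family indexed by `Idx`. -/
def objective (Qo Qp : Matrix (Fin n ⊕ Fin m ⊕ Fin m) (Fin n ⊕ Fin m ⊕ Fin m) ℝ)
    (qo qp : Fin m → ℝ) (ξ : Idx → Point H n m) : ℝ :=
  quadForm Qo (Sum.elim ((ξ .cur).x - (ξ .fix).x) (Sum.elim (ξ .cur).u (ξ .fix).u))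
    + qo ⬝ᵥ ((ξ .cur).F - (ξ .fix).F)
    + quadForm Qp (Sum.elim ((ξ .succ).x - (ξ .fix).x) (Sum.elim (ξ .succ).u (ξ .fix).u))
    + qp ⬝ᵥ ((ξ .succ).F - (ξ .fix).F)

/-- The optimal value, in `[-∞, +∞]`, of the performance estimation problem: maximize `Φ` over all
`f` in the class, all algorithm-consistent points, their successors, and all fixed points. -/
def pepValue [CompleteSpace H] (σ : Fin m → ℝ≥0) (β : Fin m → ℝ≥0∞)
    (A : Matrix (Fin n) (Fin n) ℝ) (B : Matrix (Fin n) (Fin m) ℝ)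
    (C : Matrix (Fin m) (Fin n) ℝ) (D : Matrix (Fin m) (Fin m) ℝ)
    (Φ : (Idx → Point H n m) → ℝ) : EReal :=
  sSup {v : EReal | ∃ (f : Fin m → H → EReal) (ξ : Idx → Point H n m),
    (∀ i, f i ∈ FunClass H (σ i) (β i)) ∧
    AlgConsistent C D f (ξ .cur) ∧
    IsSuccessor A B C D f (ξ .cur) (ξ .succ) ∧
    IsFixedPoint A B C D f (ξ .fix) ∧
    v = (Φ ξ : EReal)}

end Algorithm

/-! ### Matrices

For `m = 1` the type `Fin (m - 1)` is empty, so that the blocks containing `N` disappear. -/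

section Matrices

variable {n m : ℕ}

/-- The matrix `N = [I; -1ᵀ]` of size `m × (m - 1)`. -/
def matN (m : ℕ) : Matrix (Fin m) (Fin (m - 1)) ℝ :=
  Matrix.of fun i j => if i.val = j.val then 1 else if i.val = m - 1 then -1 else 0

/-- The range and null space conditions on `(A, B, C, D)`:
`ran [BN 0; DN -1] ⊆ ran [I - A; -C]` and `null [I - A, -B] ⊆ null [NᵀC NᵀD; 0 1ᵀ]`. -/
def FixedPointEncodingCond (A : Matrix (Fin n) (Fin n) ℝ) (B : Matrix (Fin n) (Fin m) ℝ)
    (C : Matrix (Fin m) (Fin n) ℝ) (D : Matrix (Fin m) (Fin m) ℝ) : Prop :=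
  LinearMap.range (Matrix.fromBlocks (B * matN m) (0 : Matrix (Fin n) Unit ℝ)
      (D * matN m) (Matrix.of fun _ _ => -1)).mulVecLin ≤
    LinearMap.range (Matrix.fromRows (1 - A) (-C)).mulVecLin ∧
  LinearMap.ker (Matrix.fromCols (1 - A) (-B)).mulVecLin ≤
    LinearMap.ker (Matrix.fromBlocks ((matN m).transpose * C) ((matN m).transpose * D)
      (0 : Matrix Unit (Fin n) ℝ) (Matrix.of fun _ _ => 1)).mulVecLin

/-- `D` is lower triangular with nonpositive diagonal, and each `i` has `β i < ∞` or
`D i i < 0`. -/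
def WellPosedCond (β : Fin m → ℝ≥0∞) (D : Matrix (Fin m) (Fin m) ℝ) : Prop :=
  (∀ i, β i < ⊤ ∨ D i i < 0) ∧ (∀ i j, i < j → D i j = 0) ∧ (∀ i, D i i ≤ 0)

/-- The index type of `ζ = (x - x⋆, u, u₊, û⋆)`, with `n + 3m - 1` elements if `m ≥ 1`. -/
abbrev ZIdx (n m : ℕ) : Type := Fin n ⊕ Fin m ⊕ Fin m ⊕ Fin (m - 1)

/-- The block row `[a b c d]`. -/
def blockRow {ι : Type*} (a : Matrix ι (Fin n) ℝ) (b c : Matrix ι (Fin m) ℝ)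
    (d : Matrix ι (Fin (m - 1)) ℝ) : Matrix ι (ZIdx n m) ℝ :=
  Matrix.fromCols a (Matrix.fromCols b (Matrix.fromCols c d))

/-- Three block rows with `m` rows each, on top of each other. -/
def stack3 {κ : Type*} (r₀ r₁ r₂ : Matrix (Fin m) κ ℝ) : Matrix (Fin 3 × Fin m) κ ℝ :=
  Matrix.of fun p => ![r₀, r₁, r₂] p.1 p.2

/-- The matrices `E_{i,j}` for distinct `i`, `j` (the value for `i = j` is never used). -/
def matE (A : Matrix (Fin n) (Fin n) ℝ) (B : Matrix (Fin n) (Fin m) ℝ)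
    (C : Matrix (Fin m) (Fin n) ℝ) (D : Matrix (Fin m) (Fin m) ℝ) :
    Idx → Idx → Matrix (Fin 3 × Fin m) (ZIdx n m) ℝ
  | .cur, .succ => stack3
      (blockRow (C * (1 - A)) (D - C * B) (-D) (C * B * matN m))
      (blockRow 0 1 0 0)
      (blockRow 0 0 1 0)
  | .cur, .fix => stack3
      (blockRow C D 0 (-(D * matN m)))
      (blockRow 0 1 0 0)
      (blockRow 0 0 0 (matN m))
  | .succ, .cur => stack3
      (blockRow (C * (A - 1)) (C * B - D) D (-(C * B * matN m)))
      (blockRow 0 0 1 0)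
      (blockRow 0 1 0 0)
  | .fix, .cur => stack3
      (blockRow (-C) (-D) 0 (D * matN m))
      (blockRow 0 0 0 (matN m))
      (blockRow 0 1 0 0)
  | .succ, .fix => stack3
      (blockRow (C * A) (C * B) D (-(D * matN m) - C * B * matN m))
      (blockRow 0 0 1 0)
      (blockRow 0 0 0 (matN m))
  | .fix, .succ => stack3
      (blockRow (-(C * A)) (-(C * B)) (-D) (D * matN m + C * B * matN m))
      (blockRow 0 0 0 (matN m))
      (blockRow 0 0 1 0)
  | .cur, .cur => 0
  | .succ, .succ => 0
  | .fix, .fix => 0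

/-- The matrices `H_{i,j}` for distinct `i`, `j` (the value for `i = j` is never used). -/
def matH (m : ℕ) : Idx → Idx → Matrix (Fin m) (Fin m ⊕ Fin m) ℝ
  | .cur, .succ => Matrix.fromCols 1 (-1)
  | .succ, .cur => Matrix.fromCols (-1) 1
  | .cur, .fix => Matrix.fromCols 1 0
  | .fix, .cur => Matrix.fromCols (-1) 0
  | .succ, .fix => Matrix.fromCols 0 1
  | .fix, .succ => Matrix.fromCols 0 (-1)
  | .cur, .cur => 0
  | .succ, .succ => 0
  | .fix, .fix => 0

/-- The interpolation matrix `M_l`. -/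
def matMl (σ : Fin m → ℝ≥0) (β : Fin m → ℝ≥0∞) (l : Fin m) :
    Matrix (Fin 3 × Fin m) (Fin 3 × Fin m) ℝ :=
  let s : ℝ := σ l
  let b : ℝ := (β l).toReal
  if β l < ⊤ then
    (1 / (2 * (b - s))) •
      (!![b * s, -s, b; -s, 1, -1; b, -1, 1] ⊗ₖ Matrix.diagonal (Pi.single l (1 : ℝ)))
  else
    (1 / 2 : ℝ) •
      (!![s, 0, 1; 0, 0, 0; 1, 0, 0] ⊗ₖ Matrix.diagonal (Pi.single l (1 : ℝ)))

/-- The vector `a_l = -e_l`. -/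
def vecAl (l : Fin m) : Fin m → ℝ := -Pi.single l 1

/-- `M_{(l,i,j)} = E_{i,j}ᵀ M_l E_{i,j}`. -/
def matM (σ : Fin m → ℝ≥0) (β : Fin m → ℝ≥0∞)
    (A : Matrix (Fin n) (Fin n) ℝ) (B : Matrix (Fin n) (Fin m) ℝ)
    (C : Matrix (Fin m) (Fin n) ℝ) (D : Matrix (Fin m) (Fin m) ℝ)
    (l : Fin m) (i j : Idx) : Matrix (ZIdx n m) (ZIdx n m) ℝ :=
  (matE A B C D i j).transpose * matMl σ β l * matE A B C D i j

/-- `a_{(l,i,j)} = H_{i,j}ᵀ a_l`. -/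
def vecA (l : Fin m) (i j : Idx) : Fin m ⊕ Fin m → ℝ :=
  (matH m i j).transpose.mulVec (vecAl l)

/-- The matrix `Σ_ø`. -/
def sigmaCur (n m : ℕ) : Matrix (Fin n ⊕ Fin m ⊕ Fin m) (ZIdx n m) ℝ :=
  Matrix.fromRows (blockRow 1 0 0 0)
    (Matrix.fromRows (blockRow 0 1 0 0) (blockRow 0 0 0 (matN m)))

/-- The matrix `Σ_+`. -/
def sigmaSucc (A : Matrix (Fin n) (Fin n) ℝ) (B : Matrix (Fin n) (Fin m) ℝ) :
    Matrix (Fin n ⊕ Fin m ⊕ Fin m) (ZIdx n m) ℝ :=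
  Matrix.fromRows (blockRow A B 0 (-(B * matN m)))
    (Matrix.fromRows (blockRow 0 0 1 0) (blockRow 0 0 0 (matN m)))

/-- `Q = Σ_øᵀ Q_ø Σ_ø + Σ_+ᵀ Q_+ Σ_+`. -/
def matQ (A : Matrix (Fin n) (Fin n) ℝ) (B : Matrix (Fin n) (Fin m) ℝ)
    (Qo Qp : Matrix (Fin n ⊕ Fin m ⊕ Fin m) (Fin n ⊕ Fin m ⊕ Fin m) ℝ) :
    Matrix (ZIdx n m) (ZIdx n m) ℝ :=
  (sigmaCur n m).transpose * Qo * sigmaCur n m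
    + (sigmaSucc A B).transpose * Qp * sigmaSucc A B

/-- Feasibility, for the scalars `lam l i j`, of the system
`lam ≥ 0`, `-Q + ∑ lam l i j • M_{(l,i,j)} ⪰ 0`, `-q + ∑ lam l i j • a_{(l,i,j)} = 0`, with
`i`, `j` ranging over the distinct elements of `I`. -/
def CertificateFeasible (σ : Fin m → ℝ≥0) (β : Fin m → ℝ≥0∞)
    (A : Matrix (Fin n) (Fin n) ℝ) (B : Matrix (Fin n) (Fin m) ℝ)
    (C : Matrix (Fin m) (Fin n) ℝ) (D : Matrix (Fin m) (Fin m) ℝ)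
    (I : Finset Idx)
    (Qo Qp : Matrix (Fin n ⊕ Fin m ⊕ Fin m) (Fin n ⊕ Fin m ⊕ Fin m) ℝ)
    (qo qp : Fin m → ℝ) : Prop :=
  ∃ lam : Fin m → Idx → Idx → ℝ,
    (∀ l, ∀ i ∈ I, ∀ j ∈ I, i ≠ j → 0 ≤ lam l i j) ∧
    (-matQ A B Qo Qp
      + ∑ l, ∑ p ∈ I.offDiag, lam l p.1 p.2 • matM σ β A B C D l p.1 p.2).PosSemidef ∧
    -Sum.elim qo qp + ∑ l, ∑ p ∈ I.offDiag, lam l p.1 p.2 • vecA l p.1 p.2 = 0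

/-- Existence of `G ≻ 0` and `χ` with `a_{(l,i,j)}ᵀ χ + trace (M_{(l,i,j)} G) ≤ 0` for all `l`
and all distinct `i`, `j` in `I`. -/
def SlaterPoint (σ : Fin m → ℝ≥0) (β : Fin m → ℝ≥0∞)
    (A : Matrix (Fin n) (Fin n) ℝ) (B : Matrix (Fin n) (Fin m) ℝ)
    (C : Matrix (Fin m) (Fin n) ℝ) (D : Matrix (Fin m) (Fin m) ℝ)
    (I : Finset Idx) : Prop :=
  ∃ (G : Matrix (ZIdx n m) (ZIdx n m) ℝ) (χ : Fin m ⊕ Fin m → ℝ), G.PosDef ∧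
    ∀ l, ∀ i ∈ I, ∀ j ∈ I, i ≠ j →
      vecA l i j ⬝ᵥ χ + (matM σ β A B C D l i j * G).trace ≤ 0

end Matrices

end QuadPEP

end

/-!
A point of the performance estimation problem enters the objective and the interpolation conditions
only through `ζ = (x - x⋆, u, u₊, û)`, where `u⋆ = N û`, and through
`χ = (F - F⋆, F₊ - F⋆)`: the matrices `E_{i,j}` extract `(y_i - y_j, u_i, u_j)` from `ζ`
(`LinearConsistent.tensorId_matE`), so that the interpolation condition for `f_l` between the points
`i` and `j` reads `a_{(l,i,j)} ⬝ χ + 𝒬(M_{(l,i,j)}, ζ) ≤ 0`, and the objective is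
`q ⬝ χ + 𝒬(Q, ζ)`.

The interpolation conditions hold for all functions in the class (`interpBound_le_of_mem_funClass`).
Hence a certificate bounds the objective by a nonnegative combination of nonpositive terms
(`CertificateFeasible.pepValue_le`).

For the converse, the quadratic forms depend on `ζ` only through its Gram matrix `G`. Conic duality
(`exists_multipliers`) produces a certificate as soon as `q ⬝ χ + trace (Q G) ≤ 0` for all `G ⪰ 0` and
`χ` that satisfy the interpolation inequalities; the positive definite `G` in the hypothesis makes the
cone of certified functionals closed, which separation requires. It remains to realize every such pair
`(G, χ)` by a feasible point (`exists_feasible_objective_eq`). The dimension of `H` suffices to write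
`G` as a Gram matrix, the range condition provides `x⋆`, and the functions come from
`exists_interpolant`: `(σ/2)‖x‖²` plus the maximum of `c + ⟪s, x⟫ - (τ/2)‖s‖²` over the convex hull of
finitely many pairs `(s, c)`, with `τ = 1 / (β - σ)` or `τ = 0`. First-order optimality of the maximizer
yields smoothness and subgradients at once, and increasing `τ` is a proximal step, so the proximal
inclusions that define a successor can be solved explicitly for these functions. If the successor does
not take part in the interpolation, it is found in this way, one component after the other because `D`
is lower triangular, and the objective does not depend on it.
-/

noncomputable section

namespace QuadPEP

/-! ### Interpolation conditions of strongly convex functions -/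

section Interpolation

variable {H : Type*} [NormedAddCommGroup H] [InnerProductSpace ℝ H]

/-- The reciprocal `1 / (b - s)` of the curvature gap, read as `0` if `b = ∞`. -/
def invGap (s : ℝ≥0) (b : ℝ≥0∞) : ℝ := if b < ⊤ then (b.toReal - s)⁻¹ else 0

/-- The lower bound for `f x - f y` with `x - y = d`, `u ∈ ∂f(x)` and `v ∈ ∂f(y)` that holds for
`s`-strongly convex and `b`-smooth `f`. -/
def interpBound (s : ℝ≥0) (b : ℝ≥0∞) (d u v : H) : ℝ :=
  inner ℝ v d + s / 2 * ‖d‖ ^ 2 + invGap s b / 2 * ‖u - v - (s : ℝ) • d‖ ^ 2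

lemma invGap_nonneg {s : ℝ≥0} {b : ℝ≥0∞} (h : (s : ℝ≥0∞) < b) : 0 ≤ invGap s b := by
  unfold invGap
  split_ifs with hb
  · have : (s : ℝ) < b.toReal := by
      simpa using (ENNReal.toReal_lt_toReal ENNReal.coe_ne_top hb.ne).2 h
    exact inv_nonneg.2 (by linarith)
  · exact le_rfl

/-- A subgradient inequality for a strongly convex function improves by the quadratic term. -/
lemma StronglyConvexFun.add_sq_le {s : ℝ} {f : H → EReal} (hf : StronglyConvexFun s f)
    {x u z : H} {r q : ℝ} (hu : u ∈ subdiff f x) (hx : f x = r) (hz : f z = q) :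
    r + inner ℝ u (z - x) + s / 2 * ‖z - x‖ ^ 2 ≤ q := by
  have key : ∀ t ∈ Set.Ioc (0 : ℝ) 1,
      r + inner ℝ u (z - x) + s / 2 * (1 - t) * ‖z - x‖ ^ 2 ≤ q := by
    rintro t ⟨ht0, ht1⟩
    have h1 := hf.2 x z t ht0.le ht1
    have h2 := hu ((1 - t) • x + t • z)
    simp only [hx, hz] at h1 h2
    generalize f ((1 - t) • x + t • z) = w at h1 h2
    have h3 : (r : EReal) + ((inner ℝ u ((1 - t) • x + t • z - x) : ℝ) : EReal)
        - ((s / 2 * ‖(1 - t) • x + t • z‖ ^ 2 : ℝ) : EReal) ≤ _ :=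
      (EReal.sub_le_sub h2 le_rfl).trans h1
    norm_cast at h3
    have e1 : (1 - t) • x + t • z - x = t • (z - x) := by module
    rw [e1, real_inner_smul_right] at h3
    have e2 : (1 - t) * ‖x‖ ^ 2 + t * ‖z‖ ^ 2 - ‖(1 - t) • x + t • z‖ ^ 2
        = t * (1 - t) * ‖z - x‖ ^ 2 := by
      simp only [← real_inner_self_eq_norm_sq, inner_add_left, inner_add_right, inner_sub_left,
        inner_sub_right, real_inner_smul_left, real_inner_smul_right, real_inner_comm z x]
      ring
    have h4 : t * (r + inner ℝ u (z - x) + s / 2 * (1 - t) * ‖z - x‖ ^ 2) ≤ t * q := by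
      linear_combination h3 - s / 2 * e2
    exact le_of_mul_le_mul_left h4 ht0
  have hc : Filter.Tendsto (fun t : ℝ => r + inner ℝ u (z - x) + s / 2 * (1 - t) * ‖z - x‖ ^ 2)
      (nhdsWithin 0 (Set.Ioi 0))
      (nhds (r + inner ℝ u (z - x) + s / 2 * (1 - 0) * ‖z - x‖ ^ 2)) := by
    apply Filter.Tendsto.mono_left _ nhdsWithin_le_nhds
    exact Continuous.tendsto (by fun_prop) 0
  have := le_of_tendsto hc (Filter.mem_of_superset (Ioc_mem_nhdsGT one_pos) key)
  simpa using this

/-- A differentiable function has no subgradient other than its gradient. -/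
lemma eq_gradient_of_mem_subdiff [CompleteSpace H] {g : H → ℝ} (hg : Differentiable ℝ g) {x u : H}
    (hu : u ∈ subdiff (fun x => (g x : EReal)) x) : u = gradient g x := by
  have hmin : IsLocalMin (fun y => g y - inner ℝ u y) x := by
    refine Filter.Eventually.of_forall fun y => ?_
    have h : (g x : EReal) + ((inner ℝ u (y - x) : ℝ) : EReal) ≤ g y := hu y
    norm_cast at h
    rw [inner_sub_right] at h
    linarith
  have h1 : HasFDerivAt (fun y => g y - inner ℝ u y)
      (InnerProductSpace.toDual ℝ H (gradient g x) - innerSL ℝ u) x :=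
    (hg x).hasGradientAt.hasFDerivAt.sub (innerSL ℝ u).hasFDerivAt
  have h2 := hmin.hasFDerivAt_eq_zero h1
  refine ext_inner_right ℝ fun v => ?_
  have h3 : inner ℝ (gradient g x) v - inner ℝ u v = 0 := DFunLike.congr_fun h2 v
  linarith

/-- The descent lemma. -/
lemma le_add_of_lipschitz_gradient [CompleteSpace H] {g : H → ℝ} (hg : Differentiable ℝ g) {b : ℝ}
    (hb : ∀ x y, ‖gradient g x - gradient g y‖ ≤ b * ‖x - y‖) (x z : H) :
    g z ≤ g x + inner ℝ (gradient g x) (z - x) + b / 2 * ‖z - x‖ ^ 2 := by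
  have hline : ∀ t : ℝ, HasDerivAt (fun t : ℝ => x + t • (z - x)) (z - x) t := fun t => by
    simpa using ((hasDerivAt_id t).smul_const (z - x)).const_add x
  have hd : ∀ t : ℝ, HasDerivAt (fun t : ℝ => g (x + t • (z - x)))
      (inner ℝ (gradient g (x + t • (z - x))) (z - x)) t := fun t => by
    have h := (hg (x + t • (z - x))).hasGradientAt.hasFDerivAt
    exact h.comp_hasDerivAt t (hline t)
  have hB : ∀ t : ℝ, HasDerivAt
      (fun t : ℝ => g x + t * inner ℝ (gradient g x) (z - x) + b / 2 * ‖z - x‖ ^ 2 * t ^ 2)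
      (inner ℝ (gradient g x) (z - x) + b * ‖z - x‖ ^ 2 * t) t := fun t => by
    have h := (((hasDerivAt_id' t).mul_const (inner ℝ (gradient g x) (z - x))).const_add
      (g x)).fun_add (((hasDerivAt_id' t).fun_pow 2).const_mul (b / 2 * ‖z - x‖ ^ 2))
    refine h.congr_deriv ?_
    norm_num
    ring
  have := image_le_of_deriv_right_le_deriv_boundary
    (f := fun t : ℝ => g (x + t • (z - x))) (a := 0) (b := 1)
    (fun t _ => (hd t).continuousAt.continuousWithinAt) (fun t _ => (hd t).hasDerivWithinAt)
    (by simp) (fun t _ => (hB t).continuousAt.continuousWithinAt)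
    (fun t _ => (hB t).hasDerivWithinAt) (fun t ht => ?_) (Set.right_mem_Icc.2 zero_le_one)
  · simpa using this
  · have h1 : inner ℝ (gradient g (x + t • (z - x)) - gradient g x) (z - x)
        ≤ b * (t * ‖z - x‖) * ‖z - x‖ := by
      refine (real_inner_le_norm _ _).trans (mul_le_mul_of_nonneg_right ?_ (norm_nonneg _))
      refine (hb _ _).trans_eq ?_
      rw [add_sub_cancel_left, norm_smul, Real.norm_of_nonneg ht.1]
    rw [inner_sub_left] at h1
    nlinarith

/-- The interpolation conditions are necessary. In the smooth case, `h = f - (s/2)‖·‖²` is convex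
and satisfies the descent lemma with constant `L = b - s`; the bound results from comparing the
affine minorant of `h` at `y` with the quadratic majorant of `h` at `x`, at the point where the
difference of the two is smallest. -/
theorem interpBound_le_of_mem_funClass [CompleteSpace H] {s : ℝ≥0} {b : ℝ≥0∞}
    (hsb : (s : ℝ≥0∞) < b) {f : H → EReal} (hf : f ∈ FunClass H s b) {x y u v : H} {r q : ℝ}
    (hu : u ∈ subdiff f x) (hv : v ∈ subdiff f y) (hx : (r : EReal) = f x)
    (hy : (q : EReal) = f y) :
    q + interpBound s b (x - y) u v ≤ r := by
  obtain ⟨-, hsc, hsm, -⟩ := hf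
  unfold interpBound invGap
  split_ifs with hb
  · obtain ⟨g, hfg, hg, hlip⟩ := hsm hb
    obtain rfl : f = fun x => (g x : EReal) := funext hfg
    have hL : 0 < b.toReal - s := by
      have : (s : ℝ) < b.toReal := by
        simpa using (ENNReal.toReal_lt_toReal ENNReal.coe_ne_top hb.ne).2 hsb
      linarith
    set L := b.toReal - s with hLdef
    have hug := eq_gradient_of_mem_subdiff hg hu
    obtain rfl : r = g x := EReal.coe_injective hx
    obtain rfl : q = g y := EReal.coe_injective hy
    set p := u - v - (s : ℝ) • (x - y) with hp
    -- `z` minimizes the difference of majorant and minorant.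
    set z := x - L⁻¹ • p with hz
    have h1 := le_add_of_lipschitz_gradient hg hlip x z
    have h2 := hsc.add_sq_le (z := z) hv rfl rfl
    rw [← hug] at h1
    have hbL : b.toReal = L + s := by rw [hLdef]; ring
    rw [hbL] at h1
    have e1 : z - x = -(L⁻¹ • p) := by rw [hz]; abel
    have e2 : z - y = (x - y) - L⁻¹ • p := by rw [hz]; abel
    rw [e1] at h1
    rw [e2] at h2
    have hup : u = p + v + (s : ℝ) • (x - y) := by rw [hp]; abel
    rw [hup] at h1
    generalize x - y = d at *
    have hLi : L * L⁻¹ = 1 := mul_inv_cancel₀ hL.ne'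
    simp only [← real_inner_self_eq_norm_sq, inner_add_left, inner_sub_left,
      inner_sub_right, real_inner_smul_left, real_inner_smul_right, inner_neg_left, inner_neg_right,
      real_inner_comm p d] at h1 h2 ⊢
    have e3 : L * (L⁻¹ * (L⁻¹ * inner ℝ p p)) = L⁻¹ * inner ℝ p p := by
      rw [← mul_assoc, hLi, one_mul]
    nlinarith
  · have := hsc.add_sq_le (z := x) hv hy.symm hx.symm
    simpa [add_assoc] using this

end Interpolation

/-! ### Construction of interpolating functions -/

section Interpolant

variable {H : Type*} [NormedAddCommGroup H] [InnerProductSpace ℝ H]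

/-- The first-order optimality condition for maximizing `w.2 + ⟪w.1, x⟫ - (τ/2)‖w.1‖²` over the
convex set `W` of affine functions, encoded by slope and constant term. -/
def IsOpt (W : Set (H × ℝ)) (τ : ℝ) (x : H) (w : H × ℝ) : Prop :=
  w ∈ W ∧ ∀ w' ∈ W, w'.2 + inner ℝ w'.1 x ≤
    w.2 + inner ℝ w.1 x + τ * inner ℝ w.1 (w'.1 - w.1)

/-- The function `w.2 + ⟪w.1, x⟫ - (τ/2)‖w.1‖²` whose maximum over `w` is a convex function of `x`
that is `1 / τ`-smooth if `τ > 0`. -/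
def penalized (τ : ℝ) (x : H) (w : H × ℝ) : ℝ := w.2 + inner ℝ w.1 x - τ / 2 * ‖w.1‖ ^ 2

lemma exists_isOpt {W : Set (H × ℝ)} (hc : IsCompact W) (hconv : Convex ℝ W) (hne : W.Nonempty)
    (τ : ℝ) (x : H) : ∃ w, IsOpt W τ x w := by
  obtain ⟨w, hw, hmax⟩ := hc.exists_isMaxOn hne
    (f := penalized τ x) (by unfold penalized; fun_prop)
  refine ⟨w, hw, fun w' hw' => ?_⟩
  have key : ∀ t ∈ Set.Ioc (0 : ℝ) 1, w'.2 + inner ℝ w'.1 x ≤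
      w.2 + inner ℝ w.1 x + τ * inner ℝ w.1 (w'.1 - w.1) + τ * t / 2 * ‖w'.1 - w.1‖ ^ 2 := by
    rintro t ⟨ht0, ht1⟩
    have h1 : penalized τ x (w + t • (w' - w)) ≤ penalized τ x w :=
      hmax (hconv.add_smul_sub_mem hw hw' ⟨ht0.le, ht1⟩)
    refine le_of_mul_le_mul_left ?_ ht0
    simp only [penalized, Prod.fst_add, Prod.snd_add, Prod.smul_fst, Prod.smul_snd, Prod.fst_sub,
      Prod.snd_sub, smul_eq_mul, ← real_inner_self_eq_norm_sq, inner_add_left, inner_add_right,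
      inner_sub_left, inner_sub_right, real_inner_smul_left, real_inner_smul_right,
      real_inner_comm w.1 w'.1] at h1 ⊢
    linarith
  have hlim : Filter.Tendsto (fun t : ℝ => w.2 + inner ℝ w.1 x + τ * inner ℝ w.1 (w'.1 - w.1)
      + τ * t / 2 * ‖w'.1 - w.1‖ ^ 2) (nhdsWithin 0 (Set.Ioi 0))
      (nhds (w.2 + inner ℝ w.1 x + τ * inner ℝ w.1 (w'.1 - w.1)
        + τ * 0 / 2 * ‖w'.1 - w.1‖ ^ 2)) :=
    (Continuous.tendsto (by fun_prop) 0).mono_left nhdsWithin_le_nhds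
  simpa using ge_of_tendsto hlim (Filter.mem_of_superset (Ioc_mem_nhdsGT one_pos) key)

lemma IsOpt.penalized_add_sq_le {W : Set (H × ℝ)} {τ : ℝ} {x : H} {w w' : H × ℝ}
    (h : IsOpt W τ x w) (hw' : w' ∈ W) :
    penalized τ x w' + τ / 2 * ‖w.1 - w'.1‖ ^ 2 ≤ penalized τ x w := by
  have h1 := h.2 w' hw'
  simp only [penalized, ← real_inner_self_eq_norm_sq, inner_sub_left, inner_sub_right,
    real_inner_comm w.1 w'.1] at h1 ⊢
  linarith

lemma IsOpt.penalized_eq {W : Set (H × ℝ)} {τ : ℝ} (hτ : 0 ≤ τ) {x : H} {w w' : H × ℝ}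
    (h : IsOpt W τ x w) (h' : IsOpt W τ x w') : penalized τ x w = penalized τ x w' := by
  have h1 := h.penalized_add_sq_le h'.1
  have h2 := h'.penalized_add_sq_le h.1
  have : 0 ≤ τ / 2 * ‖w.1 - w'.1‖ ^ 2 := by positivity
  have : 0 ≤ τ / 2 * ‖w'.1 - w.1‖ ^ 2 := by positivity
  linarith

/-- Increasing the penalty parameter amounts to a proximal step. -/
lemma IsOpt.prox {W : Set (H × ℝ)} {τ γ : ℝ} {x : H} {w : H × ℝ} (h : IsOpt W (τ + γ) x w) :
    IsOpt W τ (x - γ • w.1) w := by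
  refine ⟨h.1, fun w' hw' => ?_⟩
  have h1 := h.2 w' hw'
  simp only [inner_sub_right, real_inner_smul_right, real_inner_comm w.1 w'.1] at h1 ⊢
  linarith

lemma hasGradientAt_of_lipschitz_subgradient [CompleteSpace H] {g : H → ℝ} {p : H → H} {b : ℝ}
    (hsub : ∀ x y, g y + inner ℝ (p y) (x - y) ≤ g x)
    (hlip : ∀ x y, ‖p x - p y‖ ≤ b * ‖x - y‖) (x : H) : HasGradientAt g (p x) x := by
  rw [hasGradientAt_iff_isLittleO]
  refine Asymptotics.IsBigO.trans_isLittleO (g := fun y => ‖y - x‖ ^ 2) ?_ ?_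
  · refine Asymptotics.IsBigO.of_bound b (Filter.Eventually.of_forall fun y => ?_)
    have h1 := hsub x y
    have h2 := hsub y x
    have h3 : inner ℝ (p y - p x) (y - x) ≤ b * ‖y - x‖ * ‖y - x‖ :=
      (real_inner_le_norm _ _).trans (mul_le_mul_of_nonneg_right (hlip _ _) (norm_nonneg _))
    rw [← neg_sub y x, inner_neg_right] at h1
    rw [inner_sub_left] at h3
    rw [Real.norm_of_nonneg (by linarith), Real.norm_of_nonneg (by positivity)]
    linarith
  · simpa using Asymptotics.isLittleO_pow_sub_sub x one_lt_two

/-- A real function with a subgradient everywhere that improves by a quadratic term is, after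
adding `(s/2)‖·‖²`, in the function class. -/
lemma mem_funClass_of_subgradient [CompleteSpace H] {s : ℝ≥0} {b : ℝ≥0∞} (hsb : (s : ℝ≥0∞) < b)
    {h : H → ℝ} {p : H → H}
    (hp : ∀ x y, h y + inner ℝ (p y) (x - y) + invGap s b / 2 * ‖p x - p y‖ ^ 2 ≤ h x) :
    (fun x => ((s / 2 * ‖x‖ ^ 2 + h x : ℝ) : EReal)) ∈ FunClass H s b := by
  have hτ := invGap_nonneg hsb
  have hp' : ∀ x y, h y + inner ℝ (p y) (x - y) ≤ h x := fun x y =>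
    (le_add_of_nonneg_right (by positivity)).trans (hp x y)
  have hsub : ∀ x y, (s / 2 * ‖y‖ ^ 2 + h y) + inner ℝ (p y + (s : ℝ) • y) (x - y)
      ≤ s / 2 * ‖x‖ ^ 2 + h x := fun x y => by
    have h1 := hp' x y
    have h2 : 0 ≤ (s : ℝ) / 2 * ‖x - y‖ ^ 2 := by positivity
    simp only [← real_inner_self_eq_norm_sq, inner_add_left, inner_sub_left,
      inner_sub_right, real_inner_smul_left, real_inner_comm x y] at h1 h2 ⊢
    linarith
  refine ⟨fun x => EReal.coe_ne_bot _, ⟨⟨0, EReal.coe_lt_top _⟩, fun x y t ht0 ht1 => ?_⟩,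
    fun hb => ?_, fun _ x a ha => ?_⟩
  · simp only [← EReal.coe_sub, ← EReal.coe_mul, ← EReal.coe_add, EReal.coe_le_coe_iff,
      add_sub_cancel_left]
    set z := (1 - t) • x + t • y with hz
    have h1 := mul_le_mul_of_nonneg_left (hp' x z) (sub_nonneg.2 ht1)
    have h2 := mul_le_mul_of_nonneg_left (hp' y z) ht0
    have e : (1 - t) * inner ℝ (p z) (x - z) + t * inner ℝ (p z) (y - z) = 0 := by
      rw [← real_inner_smul_right, ← real_inner_smul_right, ← inner_add_right]
      have : (1 - t) • (x - z) + t • (y - z) = 0 := by rw [hz]; module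
      rw [this, inner_zero_right]
    linarith
  · have hL : 0 < b.toReal - s := by
      have : (s : ℝ) < b.toReal := by
        simpa using (ENNReal.toReal_lt_toReal ENNReal.coe_ne_top hb.ne).2 hsb
      linarith
    have hlip : ∀ x y, ‖p x - p y‖ ≤ (b.toReal - s) * ‖x - y‖ := fun x y => by
      have h1 := hp x y
      have h2 := hp y x
      rw [norm_sub_rev (p y), ← neg_sub x y, inner_neg_right] at h2
      have h3 : invGap s b * ‖p x - p y‖ ^ 2 ≤ ‖p x - p y‖ * ‖x - y‖ := by
        refine le_trans ?_ (real_inner_le_norm _ _)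
        rw [inner_sub_left]
        linarith
      rw [invGap, if_pos hb, inv_mul_le_iff₀ hL] at h3
      rcases (norm_nonneg (p x - p y)).eq_or_lt with h0 | h0
      · rw [← h0]; positivity
      · nlinarith
    have hlip' : ∀ x y, ‖(p x + (s : ℝ) • x) - (p y + (s : ℝ) • y)‖ ≤ b.toReal * ‖x - y‖ := by
      intro x y
      calc ‖(p x + (s : ℝ) • x) - (p y + (s : ℝ) • y)‖
          = ‖(p x - p y) + (s : ℝ) • (x - y)‖ := by congr 1; module
        _ ≤ ‖p x - p y‖ + ‖(s : ℝ) • (x - y)‖ := norm_add_le _ _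
        _ ≤ _ := by
          rw [norm_smul, Real.norm_of_nonneg s.coe_nonneg]
          linarith [hlip x y]
    have hgrad := hasGradientAt_of_lipschitz_subgradient hsub hlip'
    refine ⟨_, fun x => rfl, fun x => (hgrad x).differentiableAt, fun x y => ?_⟩
    rw [(hgrad x).gradient, (hgrad y).gradient]
    exact hlip' x y
  · have hcont : Continuous fun y => ((s / 2 * ‖x‖ ^ 2 + h x
        + inner ℝ (p x + (s : ℝ) • x) (y - x) : ℝ) : EReal) :=
      continuous_coe_real_ereal.comp (by fun_prop)
    have h1 := (hcont.tendsto x).eventually_const_lt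
      (show a < _ by simpa only [sub_self, inner_zero_right, add_zero] using ha)
    filter_upwards [h1] with y hy
    exact hy.trans_le (EReal.coe_le_coe_iff.2 (hsub y x))

/-- The interpolation conditions are sufficient. The interpolating function can be chosen such that
every (possibly degenerate) proximal inclusion `u ∈ ∂f(c - γ u)` is solvable. The function is
`(s/2)‖x‖²` plus the maximum of the penalized affine functions over the convex hull of the affine
functions that belong to the data. -/
theorem exists_interpolant [CompleteSpace H] {s : ℝ≥0} {b : ℝ≥0∞} (hsb : (s : ℝ≥0∞) < b)
    {K : Type*} [Finite K] [Nonempty K] (x u : K → H) (F : K → ℝ)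
    (hF : ∀ i j, i ≠ j → F j + interpBound s b (x i - x j) (u i) (u j) ≤ F i) :
    ∃ f ∈ FunClass H s b, (∀ k, u k ∈ subdiff f (x k)) ∧ (∀ k, (F k : EReal) = f (x k)) ∧
      ∀ γ : ℝ, 0 ≤ γ → ∀ c : H, ∃ (v : H) (r : ℝ), v ∈ subdiff f (c - γ • v) ∧
        (r : EReal) = f (c - γ • v) := by
  set τ := invGap s b with hτdef
  have hτ : 0 ≤ τ := invGap_nonneg hsb
  set slope : K → H := fun k => u k - (s : ℝ) • x k with hslope
  set aff : K → H × ℝ := fun k => (slope k,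
    F k - s / 2 * ‖x k‖ ^ 2 - inner ℝ (slope k) (x k) + τ / 2 * ‖slope k‖ ^ 2) with haff
  set W : Set (H × ℝ) := convexHull ℝ (Set.range aff) with hW
  have hex : ∀ (τ : ℝ) (y : H), ∃ w, IsOpt W τ y w := exists_isOpt
    ((Set.finite_range aff).isCompact_convexHull ℝ) (convex_convexHull ℝ _)
    ((Set.range_nonempty aff).convexHull)
  choose w hw using hex τ
  have hdata : ∀ k, IsOpt W τ (x k) (aff k) := fun k => by
    refine ⟨subset_convexHull ℝ _ ⟨k, rfl⟩, fun w' hw' => ?_⟩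
    have hconv : Convex ℝ {w' : H × ℝ | w'.2 + inner ℝ w'.1 (x k) ≤ (aff k).2 +
        inner ℝ (aff k).1 (x k) + τ * inner ℝ (aff k).1 (w'.1 - (aff k).1)} := by
      intro v hv v' hv' t t' ht ht' htt
      simp only [Set.mem_ofPred_eq, Prod.fst_add, Prod.snd_add, Prod.smul_fst, Prod.smul_snd,
        smul_eq_mul, inner_add_left, inner_sub_right, inner_add_right, real_inner_smul_left,
        real_inner_smul_right] at hv hv' ⊢
      obtain rfl : t' = 1 - t := by linarith
      have h1 := mul_le_mul_of_nonneg_left hv ht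
      have h2 := mul_le_mul_of_nonneg_left hv' ht'
      linarith
    refine convexHull_min ?_ hconv hw'
    rintro _ ⟨j, rfl⟩
    by_cases hkj : k = j
    · subst hkj; simp
    have h1 := hF k j hkj
    simp only [interpBound, ← hτdef] at h1
    simp only [haff, hslope, Set.mem_ofPred_eq]
    simp only [← real_inner_self_eq_norm_sq, inner_sub_left, inner_sub_right,
      real_inner_smul_left, real_inner_smul_right, real_inner_comm (x k) (u k),
      real_inner_comm (x j) (u j), real_inner_comm (x k) (u j), real_inner_comm (x j) (u k),
      real_inner_comm (x k) (x j), real_inner_comm (u k) (u j)] at h1 ⊢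
    linarith
  have hsub : ∀ y z v, IsOpt W τ y v →
      penalized τ y v + inner ℝ v.1 (z - y) + τ / 2 * ‖(w z).1 - v.1‖ ^ 2
        ≤ penalized τ z (w z) := fun y z v hv => by
    have h1 := (hw z).penalized_add_sq_le hv.1
    simp only [penalized, inner_sub_right] at h1 ⊢
    linarith
  have hsubdiff : ∀ y v, IsOpt W τ y v → v.1 + (s : ℝ) • y ∈ subdiff
      (fun x => ((s / 2 * ‖x‖ ^ 2 + penalized τ x (w x) : ℝ) : EReal)) y := fun y v hv z => by
    have h1 := hsub y z v hv
    have h2 : 0 ≤ (s : ℝ) / 2 * ‖z - y‖ ^ 2 := by positivity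
    have h3 : 0 ≤ τ / 2 * ‖(w z).1 - v.1‖ ^ 2 := by positivity
    have h4 := (hw y).penalized_eq hτ hv
    simp only [← EReal.coe_add, EReal.coe_le_coe_iff]
    simp only [← real_inner_self_eq_norm_sq, inner_add_left, inner_sub_left,
      inner_sub_right, real_inner_smul_left, real_inner_comm z y] at h1 h2 h3 h4 ⊢
    linarith
  refine ⟨fun x => ((s / 2 * ‖x‖ ^ 2 + penalized τ x (w x) : ℝ) : EReal),
    mem_funClass_of_subgradient hsb (p := fun x => (w x).1)
      (fun x y => hsub y x (w y) (hw y)), fun k => ?_, fun k => ?_, fun γ hγ c => ?_⟩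
  · have := hsubdiff (x k) (aff k) (hdata k)
    simpa [haff, hslope] using this
  · congr 1
    rw [(hw (x k)).penalized_eq hτ (hdata k)]
    simp only [penalized, haff]
    ring
  · -- A proximal step for `h + (s/2)‖·‖²` is one for `h` with rescaled parameters.
    have hd : 0 < 1 + γ * s := by positivity
    obtain ⟨v, hv⟩ := hex (τ + γ / (1 + γ * s)) ((1 + γ * s)⁻¹ • c)
    have hv' := hv.prox
    set y := (1 + γ * (s : ℝ))⁻¹ • c - (γ / (1 + γ * s)) • v.1 with hy
    have hyc : c - γ • (v.1 + (s : ℝ) • y) = y := by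
      have : (1 + γ * (s : ℝ)) • y = c - γ • v.1 := by
        rw [hy, smul_sub, smul_smul, smul_smul, mul_inv_cancel₀ hd.ne', mul_div_cancel₀ _ hd.ne',
          one_smul]
      calc c - γ • (v.1 + (s : ℝ) • y) = (c - γ • v.1) - (γ * (s : ℝ)) • y := by module
        _ = y := by rw [← this]; module
    refine ⟨v.1 + (s : ℝ) • y, _, ?_, rfl⟩
    rw [hyc]
    exact hsubdiff y v hv'

end Interpolant

/-! ### Conic duality -/

section Conic

open Matrix

/-- The conic version of Carathéodory's theorem. -/
lemma exists_linearIndepOn_nonneg_combination {κ E : Type*} [Fintype κ] [AddCommGroup E]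
    [Module ℝ E] (v : κ → E) (c : κ → ℝ) (hc : ∀ k, 0 ≤ c k) :
    ∃ (s : Finset κ) (d : κ → ℝ), LinearIndepOn ℝ v (s : Set κ) ∧ (∀ k, 0 ≤ d k) ∧
      ∑ k ∈ s, d k • v k = ∑ k, c k • v k := by
  classical
  induction hn : (Finset.univ.filter fun k => c k ≠ 0).card using Nat.strong_induction_on
    generalizing c with
  | _ n ih =>
    set S := Finset.univ.filter fun k => c k ≠ 0 with hS
    have hcS : ∀ k, k ∈ S ↔ c k ≠ 0 := fun k => by simp [hS]
    have hsumS : ∑ k ∈ S, c k • v k = ∑ k, c k • v k :=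
      Finset.sum_subset (Finset.subset_univ S) fun k _ hk => by
        rw [not_not.1 (mt (hcS k).2 hk), zero_smul]
    by_cases hli : LinearIndepOn ℝ v (S : Set κ)
    · exact ⟨S, c, hli, hc, hsumS⟩
    · -- A linear relation on the support allows to remove one index from the support.
      obtain ⟨g, hg0, i, hiS, hi⟩ : ∃ g : κ → ℝ, ∑ k ∈ S, g k • v k = 0 ∧ ∃ i ∈ S, 0 < g i := by
        obtain ⟨g, hg0, i, hiS, hi⟩ := not_linearIndepOn_finset_iff.1 hli
        rcases hi.lt_or_gt with h | h
        · exact ⟨-g, by simp [hg0], i, hiS, by simpa using h⟩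
        · exact ⟨g, hg0, i, hiS, h⟩
      obtain ⟨j, hj, hmin⟩ := (S.filter fun k => 0 < g k).exists_min_image
        (fun k => c k / g k) ⟨i, by simp [hiS, hi]⟩
      simp only [Finset.mem_filter] at hj hmin
      set t := c j / g j with ht
      have ht0 : 0 ≤ t := div_nonneg (hc j) hj.2.le
      set c' : κ → ℝ := fun k => if k ∈ S then c k - t * g k else 0 with hc'
      have hsum : ∑ k, c' k • v k = ∑ k, c k • v k := by
        simp only [hc', ite_smul, zero_smul, Finset.sum_ite_mem, Finset.univ_inter, sub_smul,
          Finset.sum_sub_distrib, mul_smul, ← Finset.smul_sum, hg0, smul_zero, sub_zero, hsumS]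
      rw [← hsum]
      refine ih _ ?_ c' (fun k => ?_) rfl
      · rw [← hn]
        refine Finset.card_lt_card ⟨fun k hk => ?_, fun hsub => ?_⟩
        · by_contra hkS
          simp [hc', hkS] at hk
        · have := hsub hj.1
          simp only [Finset.mem_filter, Finset.mem_univ, true_and, hc', if_pos hj.1] at this
          exact this (by rw [ht, div_mul_cancel₀ _ hj.2.ne', sub_self])
      · simp only [hc']
        split_ifs with hk
        · rcases lt_or_ge 0 (g k) with h | h
          · have := hmin k ⟨hk, h⟩
            rw [le_div_iff₀ h] at this
            linarith
          · have := mul_nonpos_of_nonneg_of_nonpos ht0 h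
            linarith [hc k]
        · exact le_rfl

/-- Finitely generated cones are closed. -/
lemma isClosed_nonneg_combinations {κ E : Type*} [Fintype κ] [AddCommGroup E] [Module ℝ E]
    [TopologicalSpace E] [IsTopologicalAddGroup E] [ContinuousSMul ℝ E] [T2Space E] (v : κ → E) :
    IsClosed {x : E | ∃ c : κ → ℝ, (∀ k, 0 ≤ c k) ∧ ∑ k, c k • v k = x} := by
  classical
  have h : {x : E | ∃ c : κ → ℝ, (∀ k, 0 ≤ c k) ∧ ∑ k, c k • v k = x} =
      ⋃ s ∈ {s : Finset κ | LinearIndepOn ℝ v (s : Set κ)},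
        Fintype.linearCombination ℝ (fun k : s => v k) '' {c | ∀ k, 0 ≤ c k} := by
    ext x
    simp only [Set.mem_ofPred_eq, Set.mem_iUnion, Set.mem_image, exists_prop]
    constructor
    · rintro ⟨c, hc, rfl⟩
      obtain ⟨s, d, h1, h2, h3⟩ := exists_linearIndepOn_nonneg_combination v c hc
      refine ⟨s, h1, fun k => d k, fun k => h2 k, ?_⟩
      rw [← h3, Fintype.linearCombination_apply]
      exact Finset.sum_coe_sort s fun k => d k • v k
    · rintro ⟨s, -, c, hc, rfl⟩
      refine ⟨fun k => if hk : k ∈ s then c ⟨k, hk⟩ else 0, fun k => ?_, ?_⟩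
      · dsimp only
        split_ifs
        · exact hc _
        · exact le_rfl
      · rw [Fintype.linearCombination_apply, ← Finset.sum_subset (Finset.subset_univ s)
          fun k _ hk => by simp only [dif_neg hk, zero_smul], ← Finset.sum_coe_sort]
        exact Finset.sum_congr rfl fun k _ => by simp only [dif_pos k.2]
  rw [h]
  refine Set.Finite.isClosed_biUnion (Set.toFinite _) fun s hs => ?_
  refine (LinearMap.isClosedEmbedding_of_injective ?_).isClosedMap _ ?_
  · exact LinearMap.ker_eq_bot.2 (linearIndependent_iff_injective_fintypeLinearCombination.1 hs)
  · simp only [Set.ofPred_forall]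
    exact isClosed_iInter fun k => isClosed_le continuous_const (continuous_apply k)

variable {ι : Type*} [Fintype ι]

lemma abs_apply_le_trace_of_posSemidef {P : Matrix ι ι ℝ} (hP : P.PosSemidef) (i j : ι) :
    |P i j| ≤ P.trace := by
  classical
  have hsymm : P j i = P i j := by simpa using hP.isHermitian.apply i j
  have hdiag : ∀ k, 0 ≤ P k k := fun k => hP.diag_nonneg
  by_cases hij : i = j
  · subst hij
    rw [abs_of_nonneg (hdiag i)]
    exact Finset.single_le_sum (f := fun k => P k k) (fun k _ => hdiag k) (Finset.mem_univ i)
  have h2 : P i i + P j j ≤ P.trace := by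
    have := Finset.sum_le_sum_of_subset_of_nonneg (f := fun k => P k k)
      (Finset.subset_univ {i, j}) fun k _ _ => hdiag k
    rwa [Finset.sum_pair hij] at this
  have key : ∀ t : ℝ, 0 ≤ P i i + t * P i j + t * (P i j + t * P j j) := fun t => by
    have := hP.dotProduct_mulVec_nonneg (Pi.single i 1 + t • Pi.single j 1)
    simpa [mulVec_add, mulVec_smul, dotProduct_add, hsymm, mul_add, add_mul, hij,
      Ne.symm hij] using this
  have h3 := key 1
  have h4 := key (-1)
  rw [abs_le]
  constructor <;> linarith [hdiag i, hdiag j]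

lemma isClosed_posSemidef : IsClosed {P : Matrix ι ι ℝ | P.PosSemidef} := by
  have : {P : Matrix ι ι ℝ | P.PosSemidef} =
      {P | Pᴴ = P} ∩ ⋂ x : ι → ℝ, {P | 0 ≤ star x ⬝ᵥ (P *ᵥ x)} := by
    ext P
    simp [posSemidef_iff_dotProduct_mulVec, IsHermitian]
  rw [this]
  refine (isClosed_eq (by fun_prop) continuous_id).inter (isClosed_iInter fun x => ?_)
  exact isClosed_le continuous_const (by fun_prop)

open scoped MatrixOrder in
lemma exists_eq_conjTranspose_mul_self_of_posSemidef {P : Matrix ι ι ℝ} (hP : P.PosSemidef) :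
    ∃ R : Matrix ι ι ℝ, P = Rᴴ * R := by
  classical
  exact CStarAlgebra.nonneg_iff_eq_star_mul_self.mp hP.nonneg

/-- The positive semidefinite matrices with bounded pairing with a positive definite matrix form a
compact set. -/
lemma isCompact_posSemidef_trace_le {G : Matrix ι ι ℝ} (hG : G.PosDef) (r : ℝ) :
    IsCompact {P : Matrix ι ι ℝ | P.PosSemidef ∧ (P * G).trace ≤ r} := by
  classical
  obtain ⟨R, rfl⟩ := exists_eq_conjTranspose_mul_self_of_posSemidef hG.posSemidef
  have hR : IsUnit R.det := by
    have := (isUnit_iff_isUnit_det _).1 hG.isUnit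
    rw [det_mul] at this
    exact isUnit_of_mul_isUnit_right this
  have hbox : IsCompact {W : Matrix ι ι ℝ | ∀ i j, |W i j| ≤ r} := by
    have h1 : {W : ι → ι → ℝ | ∀ i j, |W i j| ≤ r} =
        Set.pi Set.univ fun _ => Set.pi Set.univ fun _ => Set.Icc (-r) r := by
      ext W
      simp only [Set.mem_ofPred_eq, Set.mem_pi, Set.mem_univ, true_imp_iff, Set.mem_Icc, abs_le]
    have h2 : IsCompact {W : ι → ι → ℝ | ∀ i j, |W i j| ≤ r} := by
      rw [h1]
      exact isCompact_univ_pi fun _ => isCompact_univ_pi fun _ => isCompact_Icc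
    exact h2
  have hcont : Continuous fun W : Matrix ι ι ℝ => R⁻¹ * W * R⁻¹ᴴ := by fun_prop
  have hc := hbox.image hcont
  refine hc.of_isClosed_subset ?_ ?_
  · have htr : Continuous fun P : Matrix ι ι ℝ => (P * (Rᴴ * R)).trace := by fun_prop
    exact isClosed_posSemidef.inter (isClosed_le htr continuous_const)
  · rintro P ⟨hP, hPr⟩
    refine ⟨R * P * Rᴴ, fun i j => ?_, ?_⟩
    · refine (abs_apply_le_trace_of_posSemidef (hP.mul_mul_conjTranspose_same R) i j).trans ?_
      refine le_trans (le_of_eq ?_) hPr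
      rw [mul_assoc, trace_mul_comm, mul_assoc]
    · have h1 : R⁻¹ * R = 1 := nonsing_inv_mul R hR
      have h2 : Rᴴ * R⁻¹ᴴ = 1 := by rw [← conjTranspose_mul, h1, conjTranspose_one]
      calc R⁻¹ * (R * P * Rᴴ) * R⁻¹ᴴ = (R⁻¹ * R) * P * (Rᴴ * R⁻¹ᴴ) := by simp only [mul_assoc]
        _ = P := by rw [h1, h2, one_mul, mul_one]

open scoped Pointwise in
/-- **Conic duality.** A family of multipliers certifies that the linear functional `(Q, q)` is
nonpositive on the solutions `(G, χ)`, `G ⪰ 0`, of the linear inequalities given by `(M k, a k)`,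
provided there is a solution with `G ≻ 0`: it makes the cone of certified functionals closed,
because the positive semidefinite slack matrices of a convergent sequence stay bounded. -/
theorem exists_multipliers {κ τ : Type*} [Fintype κ] [Fintype τ] {M : κ → Matrix ι ι ℝ}
    {a : κ → τ → ℝ} (hM : ∀ k, (M k).IsSymm) {Q : Matrix ι ι ℝ} (hQ : Q.IsSymm) {q : τ → ℝ}
    {G₀ : Matrix ι ι ℝ} {χ₀ : τ → ℝ} (hG₀ : G₀.PosDef)
    (h₀ : ∀ k, a k ⬝ᵥ χ₀ + (M k * G₀).trace ≤ 0)
    (h : ∀ (G : Matrix ι ι ℝ) (χ : τ → ℝ), G.PosSemidef →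
      (∀ k, a k ⬝ᵥ χ + (M k * G).trace ≤ 0) → q ⬝ᵥ χ + (Q * G).trace ≤ 0) :
    ∃ c : κ → ℝ, (∀ k, 0 ≤ c k) ∧ (-Q + ∑ k, c k • M k).PosSemidef ∧
      -q + ∑ k, c k • a k = 0 := by
  classical
  set T : Set (Matrix ι ι ℝ × (τ → ℝ)) :=
    {x | ∃ c : κ → ℝ, (∀ k, 0 ≤ c k) ∧ ∑ k, c k • (M k, a k) = x} with hT
  have hTclosed : IsClosed T := isClosed_nonneg_combinations _
  set K : Set (Matrix ι ι ℝ × (τ → ℝ)) :=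
    {x | ∃ y ∈ T, ∃ P : Matrix ι ι ℝ, P.PosSemidef ∧ y + (-P, 0) = x} with hK
  have hTpair : ∀ y ∈ T, y.2 ⬝ᵥ χ₀ + (y.1 * G₀).trace ≤ 0 := by
    rintro _ ⟨c, hc, rfl⟩
    have : ∀ s : Finset κ, (∑ k ∈ s, c k • (M k, a k)).2 ⬝ᵥ χ₀
        + ((∑ k ∈ s, c k • (M k, a k)).1 * G₀).trace
        = ∑ k ∈ s, c k * (a k ⬝ᵥ χ₀ + (M k * G₀).trace) := fun s => by
      simp [Prod.fst_sum, Prod.snd_sum, sum_dotProduct, Finset.sum_mul, trace_sum, mul_add,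
        Finset.sum_add_distrib]
    rw [this]
    exact Finset.sum_nonpos fun k _ => mul_nonpos_of_nonneg_of_nonpos (hc k) (h₀ k)
  -- Near `x`, the slack matrices of elements of `K` have bounded pairing with `G₀`, so that `K`
  -- agrees there with the sum of a closed and a compact set.
  have hKclosed : IsClosed K := by
    refine isClosed_of_closure_subset fun x hx => ?_
    set r := -(x.2 ⬝ᵥ χ₀ + (x.1 * G₀).trace) + 1 with hr
    set S : Set (Matrix ι ι ℝ × (τ → ℝ)) :=
      (fun P => (-P, 0)) '' {P | P.PosSemidef ∧ (P * G₀).trace ≤ r} with hS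
    have hScompact : IsCompact S := (isCompact_posSemidef_trace_le hG₀ r).image (by fun_prop)
    have hTS : IsClosed (T + S) := hTclosed.add_right_of_isCompact hScompact
    have hxTS : x ∈ closure (T + S) := by
      have hU : IsOpen {z : Matrix ι ι ℝ × (τ → ℝ) | -(z.2 ⬝ᵥ χ₀ + (z.1 * G₀).trace) < r} :=
        isOpen_lt (by fun_prop) continuous_const
      rw [mem_closure_iff] at hx ⊢
      intro V hV hxV
      obtain ⟨z, ⟨hzV, hzU⟩, y, hy, P, hP, rfl⟩ := hx _ (hV.inter hU) ⟨hxV,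
        show _ < r from hr ▸ lt_add_one _⟩
      refine ⟨_, hzV, Set.add_mem_add hy ⟨P, ⟨hP, ?_⟩, rfl⟩⟩
      have := hTpair y hy
      simp only [Set.mem_ofPred_eq, Prod.fst_add, Prod.snd_add, add_zero, add_mul, neg_mul,
        trace_add, trace_neg] at hzU
      linarith
    rw [hTS.closure_eq] at hxTS
    obtain ⟨y, hy, _, ⟨P, hP, rfl⟩, rfl⟩ := hxTS
    exact ⟨y, hy, P, hP.1, rfl⟩
  by_cases hmem : (Q, q) ∈ K
  · obtain ⟨_, ⟨c, hc, rfl⟩, P, hP, hPQ⟩ := hmem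
    rw [Prod.ext_iff] at hPQ
    simp only [Prod.fst_add, Prod.snd_add, Prod.fst_sum, Prod.snd_sum, Prod.smul_fst,
      Prod.smul_snd, add_zero] at hPQ
    refine ⟨c, hc, ?_, ?_⟩
    · rw [← hPQ.1]
      convert hP using 1
      abel
    · rw [← hPQ.2, neg_add_cancel]
  exfalso
  have hTadd : ∀ {y z}, y ∈ T → z ∈ T → y + z ∈ T := by
    rintro _ _ ⟨c, hc, rfl⟩ ⟨d, hd, rfl⟩
    exact ⟨c + d, fun k => add_nonneg (hc k) (hd k), by
      simp only [Pi.add_apply, add_smul, Finset.sum_add_distrib]⟩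
  have hTsmul : ∀ {t : ℝ} {y}, 0 ≤ t → y ∈ T → t • y ∈ T := by
    rintro t _ ht ⟨c, hc, rfl⟩
    exact ⟨t • c, fun k => mul_nonneg ht (hc k), by
      simp only [Pi.smul_apply, smul_eq_mul, mul_smul, Finset.smul_sum]⟩
  have hT0 : (0 : Matrix ι ι ℝ × (τ → ℝ)) ∈ T := ⟨0, fun _ => le_rfl, by simp⟩
  let KC : ProperCone ℝ (Matrix ι ι ℝ × (τ → ℝ)) :=
    { carrier := K
      add_mem' := by
        rintro _ _ ⟨y, hy, P, hP, rfl⟩ ⟨z, hz, R, hR, rfl⟩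
        refine ⟨y + z, hTadd hy hz, P + R, hP.add hR, Prod.ext ?_ ?_⟩
        · simp only [Prod.fst_add, neg_add]
          abel
        · simp only [Prod.snd_add, add_zero]
      zero_mem' := ⟨0, hT0, 0, PosSemidef.zero, by simp⟩
      smul_mem' := by
        rintro ⟨t, ht⟩ _ ⟨y, hy, P, hP, rfl⟩
        refine ⟨t • y, hTsmul ht hy, t • P, hP.smul ht, ?_⟩
        rw [Nonneg.mk_smul, smul_add]
        simp
      isClosed' := hKclosed }
  have : LocallyConvexSpace ℝ (Matrix ι ι ℝ) := inferInstanceAs (LocallyConvexSpace ℝ (ι → ι → ℝ))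
  obtain ⟨f, hf, hfQ⟩ := KC.hyperplane_separation_point (x₀ := (Q, q)) hmem
  -- The functional is represented by a symmetric matrix `G` and a vector `χ`, up to sign.
  set G' : Matrix ι ι ℝ := of fun i j => -f (single i j 1, 0) with hG'
  set G : Matrix ι ι ℝ := (1 / 2 : ℝ) • (G' + G'ᵀ) with hG
  set χ : τ → ℝ := fun t => -f (0, Pi.single t 1) with hχ
  have hfeq : ∀ (X : Matrix ι ι ℝ) (x : τ → ℝ), X.IsSymm →
      f (X, x) = -(x ⬝ᵥ χ + (X * G).trace) := fun X x hX => by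
    have h1 : f (X, x) = f (X, 0) + f (0, x) := by rw [← map_add]; simp
    have h2 : f (X, 0) = -(X * G'ᵀ).trace := by
      have : ((X, 0) : Matrix ι ι ℝ × (τ → ℝ)) = ∑ i, ∑ j, X i j • (single i j 1, 0) := by
        conv_lhs => rw [matrix_eq_sum_single X]
        ext <;> simp [Prod.fst_sum, Prod.snd_sum]
      rw [this]
      simp only [map_sum, map_smul]
      simp [trace, mul_apply, hG']
    have h3 : f (0, x) = -(x ⬝ᵥ χ) := by
      have : ((0, x) : Matrix ι ι ℝ × (τ → ℝ)) = ∑ t, x t • (0, Pi.single t 1) := by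
        conv_lhs => rw [pi_eq_sum_univ' x]
        ext <;> simp [Prod.fst_sum, Prod.snd_sum]
      rw [this]
      simp only [map_sum, map_smul]
      simp [dotProduct, hχ]
    have h4 : (X * G').trace = (X * G'ᵀ).trace := by
      rw [← trace_transpose, transpose_mul, hX.eq, trace_mul_comm]
    rw [h1, h2, h3, hG, Matrix.mul_smul, trace_smul, Matrix.mul_add, trace_add, h4, smul_eq_mul]
    ring
  have hGpsd : G.PosSemidef := by
    refine .of_dotProduct_mulVec_nonneg ?_ fun x => ?_
    · rw [IsHermitian, conjTranspose_eq_transpose_of_trivial, hG, transpose_smul, transpose_add,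
        transpose_transpose, add_comm]
    · have h1 := hf (-vecMulVec x x, 0) ⟨0, hT0, vecMulVec x x, by
        simpa using posSemidef_vecMulVec_self_star x, by simp⟩
      rw [hfeq _ _ (by simp [IsSymm, transpose_vecMulVec])] at h1
      simpa [vecMulVec_mul, trace_vecMulVec, dotProduct_mulVec, dotProduct_comm] using h1
  refine absurd (h G χ hGpsd fun k => ?_) ?_
  · have h1 := hf (M k, a k) ⟨(M k, a k), ⟨Pi.single k 1, fun j => ?_, ?_⟩, 0, PosSemidef.zero,
      by simp⟩
    · rw [hfeq _ _ (hM k)] at h1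
      linarith
    · rw [Pi.single_apply]; split_ifs <;> norm_num
    · simp [Pi.single_apply]
  · rw [hfeq _ _ hQ] at hfQ
    linarith

end Conic

/-! ### Quadratic forms on powers of a Hilbert space -/

section QuadraticForms

open Matrix

variable {H : Type*} [NormedAddCommGroup H] [InnerProductSpace ℝ H]
  {ι ι' κ μ : Type*} [Fintype κ] [Fintype μ]

lemma tensorId_add (M N : Matrix ι κ ℝ) (z : κ → H) :
    tensorId (M + N) z = tensorId M z + tensorId N z := by
  ext i; simp [tensorId, add_smul, Finset.sum_add_distrib]

lemma tensorId_neg (M : Matrix ι κ ℝ) (z : κ → H) : tensorId (-M) z = -tensorId M z := by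
  ext i; simp [tensorId]

lemma tensorId_sub (M N : Matrix ι κ ℝ) (z : κ → H) :
    tensorId (M - N) z = tensorId M z - tensorId N z := by
  rw [sub_eq_add_neg, tensorId_add, tensorId_neg, sub_eq_add_neg]

lemma tensorId_zero (z : κ → H) : tensorId (0 : Matrix ι κ ℝ) z = 0 := by
  ext i; simp [tensorId]

lemma tensorId_one [Fintype ι] [DecidableEq ι] (z : ι → H) : tensorId (1 : Matrix ι ι ℝ) z = z := by
  ext i; simp [tensorId, Matrix.one_apply]

lemma tensorId_vec_add (M : Matrix ι κ ℝ) (z w : κ → H) :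
    tensorId M (z + w) = tensorId M z + tensorId M w := by
  ext i; simp [tensorId, Finset.sum_add_distrib]

lemma tensorId_vec_sub (M : Matrix ι κ ℝ) (z w : κ → H) :
    tensorId M (z - w) = tensorId M z - tensorId M w := by
  ext i; simp [tensorId, smul_sub]

lemma tensorId_vec_zero (M : Matrix ι κ ℝ) : tensorId M (0 : κ → H) = 0 := by
  ext i; simp [tensorId]

lemma tensorId_mul (M : Matrix ι κ ℝ) (N : Matrix κ μ ℝ) (z : μ → H) :
    tensorId (M * N) z = tensorId M (tensorId N z) := by
  ext i
  simp only [tensorId, mul_apply, Finset.sum_smul, Finset.smul_sum, mul_smul]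
  exact Finset.sum_comm

lemma tensorId_fromRows (M : Matrix ι μ ℝ) (N : Matrix ι' μ ℝ) (z : μ → H) :
    tensorId (fromRows M N) z = Sum.elim (tensorId M z) (tensorId N z) := by
  ext (i | i) <;> rfl

lemma tensorId_fromCols (M : Matrix ι μ ℝ) (N : Matrix ι κ ℝ) (z : μ → H) (w : κ → H) :
    tensorId (fromCols M N) (Sum.elim z w) = tensorId M z + tensorId N w := by
  ext i; simp [tensorId]

lemma tensorId_blockRow {n m : ℕ} (a : Matrix ι (Fin n) ℝ) (b c : Matrix ι (Fin m) ℝ)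
    (d : Matrix ι (Fin (m - 1)) ℝ) (x : Fin n → H) (u v : Fin m → H) (w : Fin (m - 1) → H) :
    tensorId (blockRow a b c d) (Sum.elim x (Sum.elim u (Sum.elim v w))) =
      tensorId a x + tensorId b u + tensorId c v + tensorId d w := by
  simp only [blockRow, tensorId_fromCols, add_assoc]

lemma tensorId_stack3 {m : ℕ} (r₀ r₁ r₂ : Matrix (Fin m) κ ℝ) (z : κ → H) (k : Fin 3)
    (i : Fin m) :
    tensorId (stack3 r₀ r₁ r₂) z (k, i) = ![tensorId r₀ z, tensorId r₁ z, tensorId r₂ z] k i := by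
  fin_cases k <;> rfl

variable [Fintype ι]

lemma quadForm_add (M N : Matrix ι ι ℝ) (z : ι → H) :
    quadForm (M + N) z = quadForm M z + quadForm N z := by
  simp [quadForm, tensorId_add, inner_add_right, Finset.sum_add_distrib]

lemma quadForm_smul (c : ℝ) (M : Matrix ι ι ℝ) (z : ι → H) :
    quadForm (c • M) z = c * quadForm M z := by
  simp [quadForm, tensorId, mul_smul, ← Finset.smul_sum, real_inner_smul_right, Finset.mul_sum]

lemma quadForm_neg (M : Matrix ι ι ℝ) (z : ι → H) : quadForm (-M) z = -quadForm M z := by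
  simp [quadForm, tensorId_neg]

lemma quadForm_sum {α : Type*} (s : Finset α) (M : α → Matrix ι ι ℝ) (z : ι → H) :
    quadForm (∑ k ∈ s, M k) z = ∑ k ∈ s, quadForm (M k) z := by
  classical
  induction s using Finset.induction_on with
  | empty => simp [quadForm, tensorId_zero]
  | insert a s ha ih => rw [Finset.sum_insert ha, Finset.sum_insert ha, quadForm_add, ih]

lemma sum_inner_tensorId (E : Matrix κ ι ℝ) (z : ι → H) (w : κ → H) :
    ∑ i, inner ℝ (z i) (tensorId Eᵀ w i) = ∑ k, inner ℝ (tensorId E z k) (w k) := by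
  simp only [tensorId, inner_sum, sum_inner, real_inner_smul_left, real_inner_smul_right,
    transpose_apply]
  exact Finset.sum_comm

lemma quadForm_transpose_mul_mul (E : Matrix κ ι ℝ) (M : Matrix κ κ ℝ) (z : ι → H) :
    quadForm (Eᵀ * M * E) z = quadForm M (tensorId E z) := by
  rw [quadForm, Matrix.mul_assoc, tensorId_mul, sum_inner_tensorId, tensorId_mul, quadForm]

lemma quadForm_nonneg {M : Matrix ι ι ℝ} (hM : M.PosSemidef) (z : ι → H) : 0 ≤ quadForm M z := by
  classical
  obtain ⟨R, rfl⟩ := exists_eq_conjTranspose_mul_self_of_posSemidef hM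
  have : Rᴴ * R = Rᵀ * 1 * R := by rw [mul_one, conjTranspose_eq_transpose_of_trivial]
  rw [this, quadForm_transpose_mul_mul, quadForm, tensorId_one]
  exact Finset.sum_nonneg fun i _ => real_inner_self_nonneg

lemma quadForm_eq_trace (M : Matrix ι ι ℝ) (z : ι → H) :
    quadForm M z = (M * gram ℝ z).trace := by
  simp only [quadForm, tensorId, inner_sum, real_inner_smul_right, trace, diag, mul_apply,
    gram_apply]
  exact Finset.sum_congr rfl fun i _ => Finset.sum_congr rfl fun j _ => by
    rw [real_inner_comm]

/-- A positive semidefinite matrix is the Gram matrix of vectors in any inner product space of large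
enough dimension. -/
lemma exists_gram_eq {G : Matrix ι ι ℝ} (hG : G.PosSemidef)
    (hdim : (Fintype.card ι : Cardinal) ≤ Module.rank ℝ H) : ∃ z : ι → H, gram ℝ z = G := by
  classical
  obtain ⟨v, hv⟩ := Module.le_rank_iff.1 hdim
  have he := InnerProductSpace.gramSchmidtNormed_orthonormal hv
  set e : ι → H := InnerProductSpace.gramSchmidtNormed ℝ v ∘ Fintype.equivFin ι with he'
  have hort : Orthonormal ℝ e := he.comp _ (Fintype.equivFin ι).injective
  obtain ⟨R, rfl⟩ := exists_eq_conjTranspose_mul_self_of_posSemidef hG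
  refine ⟨tensorId Rᵀ e, ?_⟩
  ext i j
  rw [gram_apply, mul_apply]
  exact hort.inner_sum (fun k => R k i) (fun k => R k j) Finset.univ

end QuadraticForms

/-! ### Evaluation of the matrices -/

section Evaluation

open Matrix

variable {H : Type*} [NormedAddCommGroup H] [InnerProductSpace ℝ H] {n m : ℕ}

lemma matMl_isSymm (σ : Fin m → ℝ≥0) (β : Fin m → ℝ≥0∞) (l : Fin m) :
    (matMl σ β l).IsSymm := by
  have h3 : ∀ (N : Matrix (Fin 3) (Fin 3) ℝ) (c : ℝ), N.IsSymm →
      (c • (N ⊗ₖ diagonal (Pi.single l (1 : ℝ)))).IsSymm := fun N c hN => by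
    rw [IsSymm, transpose_smul, ← kroneckerMap_transpose, hN.eq, diagonal_transpose]
  unfold matMl
  split_ifs <;> refine h3 _ _ ?_ <;> ext i j <;> fin_cases i <;> fin_cases j <;> rfl

lemma quadForm_kronecker_diagonal (N : Matrix (Fin 3) (Fin 3) ℝ) (l : Fin m)
    (w : Fin 3 × Fin m → H) :
    quadForm (N ⊗ₖ diagonal (Pi.single l (1 : ℝ))) w = quadForm N fun k => w (k, l) := by
  simp only [quadForm, tensorId, inner_sum, real_inner_smul_right, Fintype.sum_prod_type,
    kronecker_apply, diagonal_apply]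
  refine Finset.sum_congr rfl fun k _ => ?_
  rw [Finset.sum_eq_single l]
  · refine Finset.sum_congr rfl fun k' _ => ?_
    rw [Finset.sum_eq_single l]
    · simp
    · intro j _ hj
      simp [hj.symm]
    · simp
  · intro i _ hi
    refine Finset.sum_eq_zero fun k' _ => Finset.sum_eq_zero fun j _ => ?_
    by_cases hij : i = j
    · simp [hij, hij ▸ hi]
    · simp [hij]
  · simp

lemma quadForm_matMl {σ : Fin m → ℝ≥0} {β : Fin m → ℝ≥0∞} (hσβ : ∀ i, (σ i : ℝ≥0∞) < β i)
    (l : Fin m) (w : Fin 3 × Fin m → H) :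
    quadForm (matMl σ β l) w = interpBound (σ l) (β l) (w (0, l)) (w (1, l)) (w (2, l)) := by
  unfold matMl interpBound invGap
  split_ifs with hb
  · have hL : 0 < (β l).toReal - σ l := by
      have : (σ l : ℝ) < (β l).toReal := by
        simpa using (ENNReal.toReal_lt_toReal ENNReal.coe_ne_top hb.ne).2 (hσβ l)
      linarith
    rw [quadForm_smul, quadForm_kronecker_diagonal]
    simp only [← real_inner_self_eq_norm_sq]
    simp [-inner_self_eq_norm_sq_to_K, quadForm, tensorId,
      Fin.sum_univ_three, inner_add_right, inner_sub_left, inner_sub_right, real_inner_smul_left,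
      real_inner_smul_right,
      real_inner_comm (w (0, l)) (w (1, l)), real_inner_comm (w (0, l)) (w (2, l)),
      real_inner_comm (w (1, l)) (w (2, l))]
    field_simp
    ring
  · rw [quadForm_smul, quadForm_kronecker_diagonal]
    simp only [← real_inner_self_eq_norm_sq]
    simp [-inner_self_eq_norm_sq_to_K, quadForm, tensorId,
      Fin.sum_univ_three, inner_add_right, real_inner_smul_right,
      real_inner_comm (w (0, l)) (w (2, l))]
    ring

/-- The vector `(x - x⋆, u, u₊, û)`. -/
def zetaVec (ξ : Idx → Point H n m) (w : Fin (m - 1) → H) : ZIdx n m → H :=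
  Sum.elim ((ξ .cur).x - (ξ .fix).x) (Sum.elim (ξ .cur).u (Sum.elim (ξ .succ).u w))

/-- The vector `(F - F⋆, F₊ - F⋆)`. -/
def chiVec (ξ : Idx → Point H n m) : Fin m ⊕ Fin m → ℝ :=
  Sum.elim ((ξ .cur).F - (ξ .fix).F) ((ξ .succ).F - (ξ .fix).F)

/-- The linear equations that relate the three points, with `u⋆ = (N ⊗ Id) w`. -/
structure LinearConsistent (A : Matrix (Fin n) (Fin n) ℝ) (B : Matrix (Fin n) (Fin m) ℝ)
    (C : Matrix (Fin m) (Fin n) ℝ) (D : Matrix (Fin m) (Fin m) ℝ) (ξ : Idx → Point H n m)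
    (w : Fin (m - 1) → H) : Prop where
  output : ∀ i, (ξ i).y = tensorId C (ξ i).x + tensorId D (ξ i).u
  succ : (ξ .succ).x = tensorId A (ξ .cur).x + tensorId B (ξ .cur).u
  fix : (ξ .fix).x = tensorId A (ξ .fix).x + tensorId B (ξ .fix).u
  fix_u : (ξ .fix).u = tensorId (matN m) w

variable {A : Matrix (Fin n) (Fin n) ℝ} {B : Matrix (Fin n) (Fin m) ℝ}
  {C : Matrix (Fin m) (Fin n) ℝ} {D : Matrix (Fin m) (Fin m) ℝ} {ξ : Idx → Point H n m}
  {w : Fin (m - 1) → H}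

lemma LinearConsistent.succ_sub_fix (h : LinearConsistent A B C D ξ w) :
    (ξ .succ).x - (ξ .fix).x = tensorId A ((ξ .cur).x - (ξ .fix).x) + tensorId B (ξ .cur).u
      - tensorId B (tensorId (matN m) w) := by
  conv_lhs => rw [h.succ, h.fix, h.fix_u]
  rw [tensorId_vec_sub]
  abel

/-- The matrices `E_{i,j}` extract `(y_i - y_j, u_i, u_j)`. -/
lemma LinearConsistent.tensorId_matE (h : LinearConsistent A B C D ξ w) {i j : Idx} (hij : i ≠ j)
    (l : Fin m) :
    tensorId (matE A B C D i j) (zetaVec ξ w) (0, l) = (ξ i).y l - (ξ j).y l ∧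
    tensorId (matE A B C D i j) (zetaVec ξ w) (1, l) = (ξ i).u l ∧
    tensorId (matE A B C D i j) (zetaVec ξ w) (2, l) = (ξ j).u l := by
  have hy : ∀ i j, (ξ i).y l - (ξ j).y l =
      (tensorId C ((ξ i).x - (ξ j).x) + tensorId D (ξ i).u - tensorId D (ξ j).u) l := fun i j => by
    simp only [h.output, tensorId_vec_sub, Pi.add_apply, Pi.sub_apply]
    abel
  have hswap : ∀ i j, (ξ i).x - (ξ j).x = ((ξ i).x - (ξ .fix).x) - ((ξ j).x - (ξ .fix).x) :=
    fun i j => by abel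
  have hu := h.fix_u
  have hs := h.succ_sub_fix
  rw [hy, hswap i j]
  cases i <;> cases j <;> first | exact absurd rfl hij | skip
  all_goals
    simp only [hs, hu, sub_self, tensorId_vec_zero, matE, tensorId_stack3, zetaVec, tensorId_blockRow,
      Matrix.mul_sub, Matrix.mul_one, tensorId_add, tensorId_sub, tensorId_neg, tensorId_mul,
      tensorId_zero, tensorId_one, tensorId_vec_add, tensorId_vec_sub, Matrix.cons_val,
      Pi.add_apply, Pi.sub_apply, Pi.neg_apply, Pi.zero_apply]
    refine ⟨by abel, by abel, by abel⟩

lemma vecA_dotProduct_chiVec {H : Type*} (ξ : Idx → Point H n m) (l : Fin m) {i j : Idx}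
    (hij : i ≠ j) : vecA l i j ⬝ᵥ chiVec ξ = (ξ j).F l - (ξ i).F l := by
  have hl : ∀ v : Fin m → ℝ, v ⬝ᵥ Pi.single l 1 = v l := fun v => by simp
  rw [vecA, ← vecMul_transpose, transpose_transpose, ← dotProduct_mulVec, vecAl, neg_dotProduct,
    dotProduct_comm, hl]
  cases i <;> cases j <;> first | exact absurd rfl hij | skip
  all_goals
    simp [matH, chiVec, neg_mulVec]

lemma LinearConsistent.vecA_add_quadForm (h : LinearConsistent A B C D ξ w)
    {σ : Fin m → ℝ≥0} {β : Fin m → ℝ≥0∞} (hσβ : ∀ i, (σ i : ℝ≥0∞) < β i) (l : Fin m)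
    {i j : Idx} (hij : i ≠ j) :
    vecA l i j ⬝ᵥ chiVec ξ + quadForm (matM σ β A B C D l i j) (zetaVec ξ w) =
      (ξ j).F l + interpBound (σ l) (β l) ((ξ i).y l - (ξ j).y l) ((ξ i).u l) ((ξ j).u l)
        - (ξ i).F l := by
  obtain ⟨h0, h1, h2⟩ := h.tensorId_matE hij l
  rw [vecA_dotProduct_chiVec ξ l hij, matM, quadForm_transpose_mul_mul, quadForm_matMl hσβ, h0, h1,
    h2]
  ring

lemma LinearConsistent.objective_eq (h : LinearConsistent A B C D ξ w)
    (Qo Qp : Matrix (Fin n ⊕ Fin m ⊕ Fin m) (Fin n ⊕ Fin m ⊕ Fin m) ℝ) (qo qp : Fin m → ℝ) :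
    objective Qo Qp qo qp ξ =
      Sum.elim qo qp ⬝ᵥ chiVec ξ + quadForm (matQ A B Qo Qp) (zetaVec ξ w) := by
  rw [matQ, quadForm_add, quadForm_transpose_mul_mul, quadForm_transpose_mul_mul]
  have h1 : tensorId (sigmaCur n m) (zetaVec ξ w) =
      Sum.elim ((ξ .cur).x - (ξ .fix).x) (Sum.elim (ξ .cur).u (ξ .fix).u) := by
    simp only [sigmaCur, zetaVec, tensorId_fromRows, tensorId_blockRow, tensorId_one,
      tensorId_zero, h.fix_u, add_zero, zero_add]
  have h2 : tensorId (sigmaSucc A B) (zetaVec ξ w) =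
      Sum.elim ((ξ .succ).x - (ξ .fix).x) (Sum.elim (ξ .succ).u (ξ .fix).u) := by
    simp only [sigmaSucc, zetaVec, tensorId_fromRows, tensorId_blockRow, tensorId_one,
      tensorId_zero, tensorId_neg, tensorId_mul, h.fix_u, h.succ_sub_fix, add_zero, zero_add,
      sub_eq_add_neg]
  rw [h1, h2, chiVec, objective, dotProduct_block]
  simp
  ring

lemma matM_isSymm (σ : Fin m → ℝ≥0) (β : Fin m → ℝ≥0∞) (l : Fin m) (i j : Idx) :
    (matM σ β A B C D l i j).IsSymm := by
  simp only [matM, IsSymm, transpose_mul, transpose_transpose, (matMl_isSymm σ β l).eq,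
    Matrix.mul_assoc]

lemma matQ_isSymm {Qo Qp : Matrix (Fin n ⊕ Fin m ⊕ Fin m) (Fin n ⊕ Fin m ⊕ Fin m) ℝ}
    (hQo : Qo.IsSymm) (hQp : Qp.IsSymm) : (matQ A B Qo Qp).IsSymm := by
  simp only [matQ, IsSymm, transpose_add, transpose_mul, transpose_transpose, hQo.eq, hQp.eq,
    Matrix.mul_assoc]

end Evaluation

/-! ### The fixed-point equations and the successor -/

section FixedPoints

open Matrix

variable {H : Type*} [NormedAddCommGroup H] [InnerProductSpace ℝ H] {n m : ℕ}
  {A : Matrix (Fin n) (Fin n) ℝ} {B : Matrix (Fin n) (Fin m) ℝ}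
  {C : Matrix (Fin m) (Fin n) ℝ} {D : Matrix (Fin m) (Fin m) ℝ}

lemma inner_tensorId_right {ι κ : Type*} [Fintype κ] (M : Matrix ι κ ℝ) (z : κ → H) (v : H)
    (i : ι) : inner ℝ v (tensorId M z i) = (M *ᵥ fun k => inner ℝ v (z k)) i := by
  simp [tensorId, mulVec, dotProduct, inner_sum, real_inner_smul_right]

/-- The null space condition, tested against all vectors of `H`, makes the subgradients at a fixed
point sum to zero. -/
lemma FixedPointEncodingCond.sum_eq_zero (h : FixedPointEncodingCond A B C D) {x : Fin n → H}
    {u : Fin m → H} (hx : x = tensorId A x + tensorId B u) : ∑ i, u i = 0 := by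
  refine ext_inner_left ℝ fun v => ?_
  have hmem : Sum.elim (fun i => inner ℝ v (x i)) (fun i => inner ℝ v (u i)) ∈
      LinearMap.ker (fromCols (1 - A) (-B)).mulVecLin := by
    rw [LinearMap.mem_ker, mulVecLin_apply, fromCols_mulVec_sumElim, sub_mulVec, one_mulVec,
      neg_mulVec]
    ext i
    have := congrArg (inner ℝ v) (congrFun hx i)
    rw [Pi.add_apply, inner_add_right, inner_tensorId_right, inner_tensorId_right] at this
    simp only [Pi.add_apply, Pi.sub_apply, Pi.neg_apply, Pi.zero_apply]
    linarith
  have h2 := h.2 hmem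
  rw [LinearMap.mem_ker, mulVecLin_apply, fromBlocks_mulVec] at h2
  have h3 := congrFun h2 (Sum.inr ())
  simpa [mulVec, dotProduct, inner_sum] using h3

lemma exists_eq_tensorId_matN (hm : 1 ≤ m) {u : Fin m → H} (hu : ∑ i, u i = 0) :
    ∃ w : Fin (m - 1) → H, u = tensorId (matN m) w := by
  obtain ⟨k, rfl⟩ : ∃ k, m = k + 1 := ⟨m - 1, by omega⟩
  refine ⟨fun j : Fin k => u j.castSucc, ?_⟩
  rw [Fin.sum_univ_castSucc] at hu
  ext i
  change u i = ∑ j : Fin k, matN (k + 1) i j • u j.castSucc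
  induction i using Fin.lastCases with
  | last =>
    have : ∀ j : Fin k, matN (k + 1) (Fin.last k) j = -1 := fun j => by
      simp [matN, j.isLt.ne']
    simp only [this, neg_smul, one_smul, Finset.sum_neg_distrib]
    exact eq_neg_of_add_eq_zero_right hu
  | cast i =>
    have : ∀ j : Fin k, matN (k + 1) i.castSucc j = if i = j then 1 else 0 := fun j => by
      simp [matN, i.isLt.ne, Fin.ext_iff]
    simp [this]

/-- By the range condition, every zero-sum family of subgradients belongs to a fixed point. -/
lemma FixedPointEncodingCond.exists_fix (h : FixedPointEncodingCond A B C D)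
    (w : Fin (m - 1) → H) :
    ∃ x : Fin n → H, x = tensorId A x + tensorId B (tensorId (matN m) w) := by
  have hcol : ∀ j, ∃ X : Fin n → ℝ, (1 - A) *ᵥ X = (B * matN m) *ᵥ Pi.single j 1 := fun j => by
    obtain ⟨X, hX⟩ := h.1 ⟨Sum.elim (Pi.single j 1) 0, rfl⟩
    refine ⟨X, ?_⟩
    rw [mulVecLin_apply, mulVecLin_apply, fromRows_mulVec, fromBlocks_mulVec] at hX
    have h2 := congrArg (fun v => v ∘ Sum.inl) hX
    simpa only [Sum.elim_comp_inl, Sum.elim_comp_inr, zero_mulVec, add_zero] using h2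
  choose X hX using hcol
  have hX' : (1 - A) * (of fun i j => X j i) = B * matN m := by
    ext i j
    have := congrFun (hX j) i
    rw [mulVec_single_one] at this
    exact this
  refine ⟨tensorId (of fun i j => X j i) w, ?_⟩
  rw [← tensorId_mul B, ← hX', Matrix.sub_mul, Matrix.one_mul, tensorId_sub, tensorId_mul]
  abel

/-- Since `D` is lower triangular, an algorithm-consistent point with given `x` is found by solving
one proximal inclusion after the other. -/
lemma exists_algConsistent (hD : ∀ i j, i < j → D i j = 0) (hDd : ∀ i, D i i ≤ 0)
    {f : Fin m → H → EReal}
    (hf : ∀ i, ∀ γ : ℝ, 0 ≤ γ → ∀ c : H, ∃ (v : H) (r : ℝ), v ∈ subdiff (f i) (c - γ • v) ∧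
      (r : EReal) = f i (c - γ • v)) (x : Fin n → H) :
    ∃ ξ : Point H n m, ξ.x = x ∧ AlgConsistent C D f ξ := by
  choose V R hV hR using fun i c => hf i (-D i i) (neg_nonneg.2 (hDd i)) c
  let step : ∀ i : Fin m, (∀ j, j < i → H) → H := fun i prev =>
    V i (tensorId C x i + ∑ j, if hj : j < i then D i j • prev j hj else 0)
  obtain ⟨u, hu⟩ : ∃ u : Fin m → H, ∀ i, u i = step i fun j _ => u j :=
    ⟨wellFounded_lt.fix step, fun i => wellFounded_lt.fix_eq step i⟩
  set c : Fin m → H := fun i => tensorId C x i + ∑ j, if j < i then D i j • u j else 0 with hc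
  have huV : ∀ i, u i = V i (c i) := fun i => by
    rw [hu i]
    simp [step, hc]
  have hy : ∀ i, (tensorId C x + tensorId D u) i = c i - (-D i i) • V i (c i) := fun i => by
    have hsum : tensorId D u i = (∑ j, if j < i then D i j • u j else 0) + D i i • u i := by
      have h1 : ∑ j, (if j = i then D i i • u i else 0) = D i i • u i := by simp
      rw [← h1, ← Finset.sum_add_distrib]
      refine Finset.sum_congr rfl fun j _ => ?_
      rcases lt_trichotomy j i with hj | rfl | hj
      · simp [hj, hj.ne]
      · simp
      · simp [hD i j hj, hj.not_gt, hj.ne']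
    rw [Pi.add_apply, hsum, ← huV, hc, neg_smul, sub_neg_eq_add, add_assoc]
  refine ⟨⟨x, u, tensorId C x + tensorId D u, fun i => R i (c i)⟩, rfl, rfl, fun i => ?_,
    fun i => ?_⟩
  · change u i ∈ subdiff (f i) ((tensorId C x + tensorId D u) i)
    rw [hy, huV]
    exact hV i (c i)
  · change (R i (c i) : EReal) = f i ((tensorId C x + tensorId D u) i)
    rw [hy]
    exact hR i (c i)

end FixedPoints

/-! ### Certificates and feasible points -/

section Certificates

open Matrix

variable {H : Type*} [NormedAddCommGroup H] [InnerProductSpace ℝ H] [CompleteSpace H] {n m : ℕ}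
  {σ : Fin m → ℝ≥0} {β : Fin m → ℝ≥0∞}
  {A : Matrix (Fin n) (Fin n) ℝ} {B : Matrix (Fin n) (Fin m) ℝ}
  {C : Matrix (Fin m) (Fin n) ℝ} {D : Matrix (Fin m) (Fin m) ℝ}
  {Qo Qp : Matrix (Fin n ⊕ Fin m ⊕ Fin m) (Fin n ⊕ Fin m ⊕ Fin m) ℝ} {qo qp : Fin m → ℝ}
  {I : Finset Idx}

/-- A certificate bounds the objective by a nonnegative combination of violations of interpolation
conditions, which are nonpositive for all functions in the class. -/
theorem CertificateFeasible.pepValue_le (hm : 1 ≤ m) (hσβ : ∀ i, (σ i : ℝ≥0∞) < β i)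
    (hfix : FixedPointEncodingCond A B C D)
    (hcert : CertificateFeasible σ β A B C D I Qo Qp qo qp) :
    pepValue σ β A B C D (objective Qo Qp qo qp : (Idx → Point H n m) → ℝ) ≤ 0 := by
  obtain ⟨lam, hlam, hpsd, hlin⟩ := hcert
  refine sSup_le ?_
  rintro _ ⟨f, ξ, hf, hcur, hsucc, hfp, rfl⟩
  obtain ⟨w, hw⟩ := exists_eq_tensorId_matN hm (hfix.sum_eq_zero hfp.1)
  have hcons : ∀ i, AlgConsistent C D f (ξ i) := by
    rintro (_ | _ | _)
    exacts [hcur, hsucc.2, hfp.2]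
  have hL : LinearConsistent A B C D ξ w := ⟨fun i => (hcons i).1, hsucc.1, hfp.1, hw⟩
  have hterm : ∀ l, ∀ p ∈ I.offDiag,
      lam l p.1 p.2 * (vecA l p.1 p.2 ⬝ᵥ chiVec ξ +
        quadForm (matM σ β A B C D l p.1 p.2) (zetaVec ξ w)) ≤ 0 := fun l p hp => by
    rw [Finset.mem_offDiag] at hp
    refine mul_nonpos_of_nonneg_of_nonpos (hlam l _ hp.1 _ hp.2.1 hp.2.2) ?_
    rw [hL.vecA_add_quadForm hσβ l hp.2.2]
    have := interpBound_le_of_mem_funClass (hσβ l) (hf l) ((hcons p.1).2.1 l) ((hcons p.2).2.1 l)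
      ((hcons p.1).2.2 l) ((hcons p.2).2.2 l)
    linarith
  have h1 := quadForm_nonneg hpsd (zetaVec ξ w)
  have h2 := congrArg (fun v => v ⬝ᵥ chiVec ξ) hlin
  simp only [quadForm_add, quadForm_neg, quadForm_sum, quadForm_smul, add_dotProduct,
    neg_dotProduct, sum_dotProduct, smul_dotProduct, zero_dotProduct, smul_eq_mul] at h1 h2
  have h3 := Finset.sum_nonpos fun l (_ : l ∈ Finset.univ) => Finset.sum_nonpos (hterm l)
  simp only [mul_add, Finset.sum_add_distrib] at h3
  rw [hL.objective_eq]
  exact_mod_cast (by linarith : _ ≤ (0 : ℝ))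

/-- A positive semidefinite `G` and a vector `χ` that satisfy the interpolation inequalities come
from a feasible point of the performance estimation problem: `G` is realized as a Gram matrix, the
fixed point results from the range condition, and the functions from interpolation. If the successor
does not take part in the interpolation, then it is replaced by an actual successor, on which the
objective does not depend. -/
theorem exists_feasible_objective_eq (hm : 1 ≤ m) (hσβ : ∀ i, (σ i : ℝ≥0∞) < β i)
    (hfix : FixedPointEncodingCond A B C D) (hwell : WellPosedCond β D)
    (hcurI : Idx.cur ∈ I) (hfixI : Idx.fix ∈ I)
    (hdep : DependsOn (objective Qo Qp qo qp : (Idx → Point H n m) → ℝ) (I : Set Idx))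
    (hdim : ((n + 3 * m - 1 : ℕ) : Cardinal) ≤ Module.rank ℝ H)
    {G : Matrix (ZIdx n m) (ZIdx n m) ℝ} {χ : Fin m ⊕ Fin m → ℝ} (hG : G.PosSemidef)
    (hineq : ∀ l, ∀ i ∈ I, ∀ j ∈ I, i ≠ j →
      vecA l i j ⬝ᵥ χ + (matM σ β A B C D l i j * G).trace ≤ 0) :
    ∃ (f : Fin m → H → EReal) (ξ : Idx → Point H n m), (∀ i, f i ∈ FunClass H (σ i) (β i)) ∧
      AlgConsistent C D f (ξ .cur) ∧ IsSuccessor A B C D f (ξ .cur) (ξ .succ) ∧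
      IsFixedPoint A B C D f (ξ .fix) ∧
      objective Qo Qp qo qp ξ = Sum.elim qo qp ⬝ᵥ χ + (matQ A B Qo Qp * G).trace := by
  classical
  obtain ⟨z, rfl⟩ : ∃ z : ZIdx n m → H, gram ℝ z = G := by
    refine exists_gram_eq hG (le_trans (le_of_eq ?_) hdim)
    simp only [Fintype.card_sum, Fintype.card_fin]
    congr 1
    omega
  set w : Fin (m - 1) → H := fun j => z (.inr (.inr (.inr j))) with hw
  obtain ⟨xs, hxs⟩ := hfix.exists_fix w
  let mk : (Fin n → H) → (Fin m → H) → (Fin m → ℝ) → Point H n m := fun x u F =>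
    ⟨x, u, tensorId C x + tensorId D u, F⟩
  let xc : Fin n → H := (fun i => z (.inl i)) + xs
  let uc : Fin m → H := fun i => z (.inr (.inl i))
  let ξ : Idx → Point H n m := fun
    | .cur => mk xc uc fun i => χ (.inl i)
    | .succ => mk (tensorId A xc + tensorId B uc) (fun i => z (.inr (.inr (.inl i))))
        fun i => χ (.inr i)
    | .fix => mk xs (tensorId (matN m) w) 0
  have hL : LinearConsistent A B C D ξ w := ⟨by rintro (_ | _ | _) <;> rfl, rfl, hxs, rfl⟩
  have hz : zetaVec ξ w = z := by
    ext (i | i | i | i)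
    · simp [zetaVec, ξ, mk, xc]
    · rfl
    · rfl
    · rfl
  have hχ : chiVec ξ = χ := by
    ext (i | i) <;> simp [chiVec, ξ, mk]
  have hI : Nonempty I := ⟨⟨_, hcurI⟩⟩
  have hint : ∀ l, _ := fun l => exists_interpolant (hσβ l) (K := I) (fun i => (ξ i).y l)
    (fun i => (ξ i).u l) (fun i => (ξ i).F l) fun i j hij => by
      have hij' : (i : Idx) ≠ j := fun h => hij (Subtype.ext h)
      have h1 := hineq l i i.2 j j.2 hij'
      rw [← quadForm_eq_trace, ← hχ, ← hz, hL.vecA_add_quadForm hσβ l hij'] at h1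
      linarith
  choose f hf hsub hval hprox using hint
  have hcons : ∀ i ∈ I, AlgConsistent C D f (ξ i) := fun i hi =>
    ⟨hL.output i, fun l => hsub l ⟨i, hi⟩, fun l => hval l ⟨i, hi⟩⟩
  obtain ⟨P, hPx, hP, hPI⟩ : ∃ P : Point H n m, P.x = (ξ .succ).x ∧ AlgConsistent C D f P ∧
      (Idx.succ ∈ I → P = ξ .succ) := by
    by_cases hs : Idx.succ ∈ I
    · exact ⟨ξ .succ, rfl, hcons _ hs, fun _ => rfl⟩
    · obtain ⟨P, hPx, hP⟩ := exists_algConsistent hwell.2.1 hwell.2.2 hprox (ξ .succ).x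
      exact ⟨P, hPx, hP, fun h => absurd h hs⟩
  refine ⟨f, Function.update ξ .succ P, hf, hcons _ hcurI, ⟨?_, ?_⟩, ⟨hxs, hcons _ hfixI⟩, ?_⟩
  · simp only [Function.update_self, hPx]
    rfl
  · simpa using hP
  · have : objective Qo Qp qo qp (Function.update ξ .succ P) = objective Qo Qp qo qp ξ :=
      hdep fun i hi => by
        by_cases his : i = .succ
        · subst his
          rw [Function.update_self, hPI hi]
        · rw [Function.update_of_ne his]
    rw [this, hL.objective_eq, hχ, hz, quadForm_eq_trace]

/-- By conic duality, a certificate exists as soon as the semidefinite relaxation in `(G, χ)` has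
nonpositive value, and that relaxation is exact because its feasible points are realized by functions
in the class. -/
theorem certificateFeasible_of_pepValue_le (hm : 1 ≤ m) (hσβ : ∀ i, (σ i : ℝ≥0∞) < β i)
    (hfix : FixedPointEncodingCond A B C D) (hwell : WellPosedCond β D)
    (hQo : Qo.IsSymm) (hQp : Qp.IsSymm) (hcurI : Idx.cur ∈ I) (hfixI : Idx.fix ∈ I)
    (hdep : DependsOn (objective Qo Qp qo qp : (Idx → Point H n m) → ℝ) (I : Set Idx))
    (hdim : ((n + 3 * m - 1 : ℕ) : Cardinal) ≤ Module.rank ℝ H)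
    (hslater : SlaterPoint σ β A B C D I)
    (hval : pepValue σ β A B C D (objective Qo Qp qo qp : (Idx → Point H n m) → ℝ) ≤ 0) :
    CertificateFeasible σ β A B C D I Qo Qp qo qp := by
  classical
  obtain ⟨G₀, χ₀, hG₀, h₀⟩ := hslater
  have hoff : ∀ {p}, p ∈ I.offDiag → p.1 ∈ I ∧ p.2 ∈ I ∧ p.1 ≠ p.2 := Finset.mem_offDiag.1
  obtain ⟨c, hc, hpsd, hlin⟩ := exists_multipliers (κ := Fin m × I.offDiag)
    (M := fun k => matM σ β A B C D k.1 k.2.1.1 k.2.1.2) (a := fun k => vecA k.1 k.2.1.1 k.2.1.2)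
    (fun k => matM_isSymm σ β _ _ _) (matQ_isSymm (A := A) (B := B) hQo hQp)
    (q := Sum.elim qo qp) hG₀
    (fun k => h₀ _ _ (hoff k.2.2).1 _ (hoff k.2.2).2.1 (hoff k.2.2).2.2)
    (fun G χ hG hineq => by
      obtain ⟨f, ξ, hf, hcur, hsucc, hfp, hobj⟩ := exists_feasible_objective_eq (H := H) hm hσβ
        hfix hwell hcurI hfixI hdep hdim hG (χ := χ) fun l i hi j hj hij =>
          hineq (l, ⟨(i, j), Finset.mem_offDiag.2 ⟨hi, hj, hij⟩⟩)
      rw [← hobj]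
      have h1 : ((objective Qo Qp qo qp ξ : ℝ) : EReal) ≤ 0 := by
        refine le_trans ?_ hval
        exact le_sSup ⟨f, ξ, hf, hcur, hsucc, hfp, rfl⟩
      exact_mod_cast h1)
  have hsum : ∀ {E : Type} [AddCommMonoid E] [Module ℝ E] (g : Fin m → Idx → Idx → E),
      ∑ l, ∑ p ∈ I.offDiag,
        (if h : p ∈ I.offDiag then c (l, ⟨p, h⟩) else 0) • g l p.1 p.2 =
      ∑ k : Fin m × I.offDiag, c k • g k.1 k.2.1.1 k.2.1.2 := fun g => by
    rw [Fintype.sum_prod_type]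
    refine Finset.sum_congr rfl fun l _ => ?_
    rw [← Finset.sum_coe_sort]
    exact Finset.sum_congr rfl fun p _ => by rw [dif_pos p.2]
  refine ⟨fun l i j => if h : (i, j) ∈ I.offDiag then c (l, ⟨(i, j), h⟩) else 0,
    fun l i hi j hj hij => ?_, ?_, ?_⟩
  · have hp : (i, j) ∈ I.offDiag := Finset.mem_offDiag.2 ⟨hi, hj, hij⟩
    simp only [dif_pos hp]
    exact hc _
  · rw [← hsum] at hpsd
    exact hpsd
  · rw [← hsum] at hlin
    exact hlin

end Certificates

end QuadPEP

end

theorem lemma1 {H : Type*} [NormedAddCommGroup H] [InnerProductSpace ℝ H] [CompleteSpace H]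
    {n m : ℕ} (hm : 1 ≤ m)
    (σ : Fin m → ℝ≥0) (β : Fin m → ℝ≥0∞) (hσβ : ∀ i, (σ i : ℝ≥0∞) < β i)
    (A : Matrix (Fin n) (Fin n) ℝ) (B : Matrix (Fin n) (Fin m) ℝ)
    (C : Matrix (Fin m) (Fin n) ℝ) (D : Matrix (Fin m) (Fin m) ℝ)
    (hfix : QuadPEP.FixedPointEncodingCond A B C D)
    (hwell : QuadPEP.WellPosedCond β D)
    (Qo Qp : Matrix (Fin n ⊕ Fin m ⊕ Fin m) (Fin n ⊕ Fin m ⊕ Fin m) ℝ)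
    (hQo : Qo.IsSymm) (hQp : Qp.IsSymm) (qo qp : Fin m → ℝ)
    (I : Finset QuadPEP.Idx)
    (hI : I = {QuadPEP.Idx.cur, QuadPEP.Idx.fix} ∨
      I = {QuadPEP.Idx.cur, QuadPEP.Idx.succ, QuadPEP.Idx.fix})
    (hdep : DependsOn
      (QuadPEP.objective Qo Qp qo qp : (QuadPEP.Idx → QuadPEP.Point H n m) → ℝ)
      (I : Set QuadPEP.Idx)) :
    (QuadPEP.CertificateFeasible σ β A B C D I Qo Qp qo qp →
      QuadPEP.pepValue σ β A B C D
        (QuadPEP.objective Qo Qp qo qp : (QuadPEP.Idx → QuadPEP.Point H n m) → ℝ) ≤ 0) ∧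
    (((n + 3 * m - 1 : ℕ) : Cardinal) ≤ Module.rank ℝ H →
      QuadPEP.SlaterPoint σ β A B C D I →
      QuadPEP.pepValue σ β A B C D
        (QuadPEP.objective Qo Qp qo qp : (QuadPEP.Idx → QuadPEP.Point H n m) → ℝ) ≤ 0 →
      QuadPEP.CertificateFeasible σ β A B C D I Qo Qp qo qp) := by
  have hcurI : QuadPEP.Idx.cur ∈ I := by rcases hI with rfl | rfl <;> decide
  have hfixI : QuadPEP.Idx.fix ∈ I := by rcases hI with rfl | rfl <;> decide
  exact ⟨fun hcert => hcert.pepValue_le hm hσβ hfix, fun hdim hslater hval =>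
    QuadPEP.certificateFeasible_of_pepValue_le hm hσβ hfix hwell hQo hQp hcurI hfixI hdep hdim
      hslater hval⟩
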